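/- Assume $V$ satisfies $\mathrm{ZFC}$. For a class $X$, let $OD(X)$ be the class of all sets $a$ such that $a$ is the unique set satisfying $\varphi(a, p_1,\dots,p_n)$ in $(V,\in)$ for some first-order formula $\varphi$ of the language of set theory and some parameters $p_1,\dots,p_n$, each of which is an ordinal or an element of $X$. Let $HOD(X)$ be the class of all sets $a$ such that $\mathrm{tcl}(\{a\}) \subseteq OD(X)$, where $\mathrm{tcl}$ denotes the transitive closure. An inner model is a transitive class $M$ that contains all ordinals, is a model of $\mathrm{ZF}$, and is a class of $V$ in the sense that the axioms of $\mathrm{ZF}$ remain valid in $V$ for formulas with an additional unary predicate interpreted by $M$. For a class $M$ let $M^\omega$ be the class of all functions in $V$ from $\omega$ to $M$. (a) If $M$ is an inner model, then $HOD(M^\omega)$ satisfies dependent choice. (b) $HOD(P(\omega))$ satisfies dependent choice. Here a class $H$ satisfies dependent choice if the following holds in the structure $(H,\in)$: whenever $A$ is a nonempty set and $R$ is a relation such that for every $x \in A$ there is $y \in A$ with $y\,R\,x$, there is a function $f : \omega \to A$ such that $f(n+1)\,R\,f(n)$ for all $n \in \omega$. -/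

import Mathlib

open FirstOrder

universe u

/-! The universe `V` is Mathlib's type `ZFSet` of sets, and a class is a `Set ZFSet`. -/

namespace HODModels

/-! ### The language of set theory and its structures -/

/-- The only non-logical symbol of the language of set theory: the binary symbol `∈`. -/
inductive MemRel : ℕ → Type
  | mem : MemRel 2

/-- The first-order language of set theory. -/
def memLang : FirstOrder.Language.{0, 0} := ⟨fun _ => Empty, MemRel⟩

/-- A binary relation `E` on `N`, as a structure for the language of set theory. -/
@[reducible] def memStructure {N : Type*} (E : N → N → Prop) : memLang.Structure N where
  funMap f := f.elim
  RelMap | .mem => fun v => E (v 0) (v 1)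

/-- `S` is definable in `(N, E)` by a first-order formula with parameters from `P`. -/
def DefinableClass {N : Type*} (E : N → N → Prop) (P : Set N) (S : Set N) : Prop :=
  letI := memStructure E
  P.Definable₁ memLang S

/-- The binary relation `F` is definable in `(N, E)` by a first-order formula with
parameters from `P`. -/
def DefinableRel {N : Type*} (E : N → N → Prop) (P : Set N) (F : Set (N × N)) : Prop :=
  letI := memStructure E
  P.Definable₂ memLang F

/-- The membership relation restricted to a class `A`. -/
def memOn (A : Set ZFSet.{u}) : A → A → Prop := fun x y => (x : ZFSet.{u}) ∈ (y : ZFSet.{u})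

/-! ### Set-theoretic notions inside a structure `(N, E)` -/

section Internal

variable {N : Type*} (E : N → N → Prop)

/-- `(N, E)` satisfies `e = ∅`. -/
def IsEmptySet (e : N) : Prop := ∀ x, ¬ E x e

/-- `(N, E)` satisfies `t = s ∪ {s}`. -/
def IsSucc (t s : N) : Prop := ∀ x, E x t ↔ E x s ∨ x = s

/-- `(N, E)` satisfies: `a` contains `∅` and is closed under `s ↦ s ∪ {s}`. -/
def IsInductive (a : N) : Prop :=
  (∃ e, E e a ∧ IsEmptySet E e) ∧ ∀ s, E s a → ∃ t, E t a ∧ IsSucc E t s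

/-- `(N, E)` satisfies `w = ω` (the least inductive set). -/
def IsOmega (w : N) : Prop :=
  IsInductive E w ∧ ∀ a, IsInductive E a → ∀ x, E x w → E x a

/-- `(N, E)` satisfies `p = (x, y) = {{x}, {x, y}}`. -/
def IsPair (p x y : N) : Prop :=
  ∃ s d, (∀ z, E z s ↔ z = x) ∧ (∀ z, E z d ↔ z = x ∨ z = y) ∧ ∀ z, E z p ↔ z = s ∨ z = d

/-- `(N, E)` satisfies `(x, y) ∈ r`. -/
def PairMem (x y r : N) : Prop := ∃ p, E p r ∧ IsPair E p x y

/-- `(N, E)` satisfies: `f` is a function from `a` to `b`. -/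
def IsFunction (f a b : N) : Prop :=
  (∀ p, E p f → ∃ x y, E x a ∧ E y b ∧ IsPair E p x y) ∧ ∀ x, E x a → ∃! y, PairMem E x y f

/-- `(N, E)` is a model of `ZF`. In the two schemes, formulas may have arbitrary parameters
from `N`. -/
structure ModelsZF : Prop where
  extensionality : ∀ a b, (∀ x, E x a ↔ E x b) → a = b
  foundation : ∀ a, (∃ x, E x a) → ∃ x, E x a ∧ ∀ y, E y x → ¬ E y a
  pairing : ∀ a b, ∃ c, ∀ x, E x c ↔ x = a ∨ x = b
  union : ∀ a, ∃ b, ∀ x, E x b ↔ ∃ y, E y a ∧ E x y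
  powerset : ∀ a, ∃ b, ∀ x, E x b ↔ ∀ y, E y x → E y a
  infinity : ∃ a, IsInductive E a
  separation : ∀ S : Set N, DefinableClass E Set.univ S →
    ∀ a, ∃ b, ∀ x, E x b ↔ E x a ∧ x ∈ S
  replacement : ∀ F : Set (N × N), DefinableRel E Set.univ F →
    ∀ a, (∀ x, E x a → ∀ y y', (x, y) ∈ F → (x, y') ∈ F → y = y') →
      ∃ b, ∀ y, E y b ↔ ∃ x, E x a ∧ (x, y) ∈ F

/-- `(N, E)` satisfies dependent choice: if `a` is a nonempty set and `r` is a relation such that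
every `x ∈ a` has some `y ∈ a` with `y r x`, then there is a sequence `f : ω → a` such that
`f (n + 1) r f n` for all `n ∈ ω`. -/
def SatisfiesDC : Prop :=
  ∀ a r : N, (∃ x, E x a) → (∀ x, E x a → ∃ y, E y a ∧ PairMem E y x r) →
    ∃ w f, IsOmega E w ∧ IsFunction E f w a ∧
      ∀ n m x y, E n w → IsSucc E m n → PairMem E n x f → PairMem E m y f → PairMem E y x r

end Internal

/-! ### Inner models -/

/-- Every class `M`, definable or not, can be used in instances of replacement (and hence of
separation) in the universe: this holds for arbitrary class relations `F`. -/
theorem class_replacement (F : ZFSet.{u} → ZFSet.{u} → Prop) (a : ZFSet.{u})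
    (hF : ∀ x ∈ a, ∀ y y', F x y → F x y' → y = y') :
    ∃ b : ZFSet.{u}, ∀ y, y ∈ b ↔ ∃ x ∈ a, F x y := by
  classical
  let b₀ : ZFSet.{u} := @ZFSet.image (fun x => if h : ∃ y, F x y then h.choose else ∅)
    (Classical.allZFSetDefinable _) a
  refine ⟨b₀.sep fun y => ∃ x ∈ a, F x y, fun y => ?_⟩
  rw [ZFSet.mem_sep]
  refine ⟨fun h => h.2, fun h => ⟨?_, h⟩⟩
  obtain ⟨x, hx, hxy⟩ := h
  have hex : ∃ y, F x y := ⟨y, hxy⟩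
  refine (@ZFSet.mem_image _ (Classical.allZFSetDefinable _) _ _).2 ⟨x, hx, ?_⟩
  rw [dif_pos hex]
  exact hF x hx _ _ hex.choose_spec hxy

/-- `M` is an inner model of `ZF`: a transitive class containing all ordinals and satisfying `ZF`.
(That the axioms of `ZF` remain valid in the universe for formulas with a predicate for `M` is
automatic, by `class_replacement`.) -/
structure IsInnerModel (M : Set ZFSet.{u}) : Prop where
  transitive : ∀ x ∈ M, ∀ y ∈ x, y ∈ M
  ordinals : ∀ x : ZFSet.{u}, x.IsOrdinal → x ∈ M
  modelsZF : ModelsZF (memOn M)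

/-! ### Relative (hereditary) ordinal definability -/

/-- `OD(X)`: the sets `a` such that `{a}` is definable in the universe `(V, ∈)` by a formula whose
parameters are ordinals and elements of `X`. -/
def OD (X : Set ZFSet.{u}) : Set ZFSet.{u} :=
  {a | DefinableClass (fun x y : ZFSet.{u} => x ∈ y) ({x | x.IsOrdinal} ∪ X) {a}}

/-- The transitive closure of `x`: the elements of every transitive set that includes `x`. -/
def tcl (x : ZFSet.{u}) : Set ZFSet.{u} :=
  {b | ∀ t : ZFSet.{u}, t.IsTransitive → x ⊆ t → b ∈ t}

/-- `HOD(X)`: the sets `a` such that `tcl({a}) ⊆ OD(X)`. -/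
def HOD (X : Set ZFSet.{u}) : Set ZFSet.{u} :=
  {a | tcl {a} ⊆ OD X}

/-- `M^ω`: the class of all functions (in the universe) from `ω` to `M`. -/
def omegaSeq (M : Set ZFSet.{u}) : Set ZFSet.{u} :=
  {f | ∃ y : ZFSet.{u}, (∀ z ∈ y, z ∈ M) ∧ ZFSet.IsFunc ZFSet.omega y f}

/-- `P(ω)`, as a class. -/
def powersetOmega : Set ZFSet.{u} := {x | x ∈ ZFSet.powerset ZFSet.omega}

end HODModels

/-! The point is that an `ω`-sequence of elements of `M^ω` is coded by a single element of `M^ω`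
(`join`, `row_join`). Let `a` and `r` lie in `HOD(M^ω)`. Every element of `a` is definable from
ordinals and some `t ∈ M^ω`, so the parameters `t_n` needed for the terms of a descending sequence
can be merged into one `T ∈ M^ω`. It remains to get rid of the infinitely many formulas and ordinals
that also occur.

For this, definability is made uniform: if `x` is definable from ordinals and `t`, then for some `α`
and some formula code `n`, `x` is the only element of `V_α` satisfying formula `n` with parameter
`t` (`exists_isDefinedIn_of_mem_dcl`). Without ordinals this is reflection; with ordinals, a
counterexample with least ordinals would be definable from `t` alone. The pairs `(α, n)` are well
ordered lexicographically, so `t` singles out one element of any set that has an element definable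
in this way (`IsChosen`).

Hence choice in the universe only has to select the `t_n`: the term `g (n + 1)` is the element
singled out by `t_(n+1)` among the `y ∈ a` with `y r g n`. So `g` is the unique solution of a
recursion with parameters `a`, `r`, `T` (`seq_mem_OD`). Its members are pairs of natural numbers and
elements of `a`, so it lies in `HOD(M^ω)`, and transitivity of that class makes the statement of
dependent choice absolute. For `P(ω)`, indicator functions reduce the claim to sequences in `{∅,
{∅}}`. -/

namespace HODModels

/-! ### Parameter-free definability in the universe -/

/-- The relation `P` is definable without parameters in the universe `(V, ∈)`. -/
class Dfn {ι : Type} (P : (ι → ZFSet.{u}) → Prop) : Prop where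
  out : let _ := memStructure (fun x y : ZFSet.{u} => x ∈ y)
    ∃ φ : memLang.Formula ι, ∀ v, φ.Realize v ↔ P v

/-- The graph of the function `f` is definable without parameters in the universe. -/
class DFun {ι : Type} (f : (ι → ZFSet.{u}) → ZFSet.{u}) : Prop where
  out : Dfn fun v : Option ι → ZFSet.{u} => v none = f fun i => v (some i)

section Framework

variable {ι κ : Type} {P Q : (ι → ZFSet.{u}) → Prop} {f g : (ι → ZFSet.{u}) → ZFSet.{u}}

theorem Dfn.congr (h : Dfn P) (hPQ : ∀ v, P v ↔ Q v) : Dfn Q := by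
  rwa [← funext fun v => propext (hPQ v)]

theorem dfn_mem_var (i j : ι) : Dfn fun v : ι → ZFSet.{u} => v i ∈ v j := by
  let _ := memStructure (fun x y : ZFSet.{u} => x ∈ y)
  refine ⟨Language.Relations.formula₂ (L := memLang) MemRel.mem (.var i) (.var j), fun v => ?_⟩
  exact Language.Formula.realize_rel₂.trans Iff.rfl

theorem dfn_eq_var (i j : ι) : Dfn fun v : ι → ZFSet.{u} => v i = v j := by
  let _ := memStructure (fun x y : ZFSet.{u} => x ∈ y)
  exact ⟨(Language.Term.var i).equal (.var j), fun v => by simp⟩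

instance Dfn.false : Dfn fun _ : ι → ZFSet.{u} => False := ⟨⊥, fun _ => Iff.rfl⟩

instance Dfn.imp [hP : Dfn P] [hQ : Dfn Q] : Dfn fun v => P v → Q v := by
  let _ := memStructure (fun x y : ZFSet.{u} => x ∈ y)
  obtain ⟨φ, hφ⟩ := hP.out
  obtain ⟨ψ, hψ⟩ := hQ.out
  exact ⟨φ.imp ψ, fun v => by simp [hφ, hψ]⟩

instance Dfn.not [hP : Dfn P] : Dfn fun v => ¬ P v := Dfn.imp (Q := fun _ => False)

instance Dfn.and [hP : Dfn P] [hQ : Dfn Q] : Dfn fun v => P v ∧ Q v :=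
  (inferInstance : Dfn fun v => ¬ (P v → ¬ Q v)).congr fun v => by tauto

instance Dfn.or [hP : Dfn P] [hQ : Dfn Q] : Dfn fun v => P v ∨ Q v :=
  (inferInstance : Dfn fun v => ¬ P v → Q v).congr fun v => by tauto

instance Dfn.iff [hP : Dfn P] [hQ : Dfn Q] : Dfn fun v => (P v ↔ Q v) :=
  (inferInstance : Dfn fun v => (P v → Q v) ∧ (Q v → P v)).congr fun v => by tauto

theorem Dfn.comp (h : Dfn P) (c : ι → κ) : Dfn fun v : κ → ZFSet.{u} => P fun i => v (c i) := by
  let _ := memStructure (fun x y : ZFSet.{u} => x ∈ y)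
  obtain ⟨φ, hφ⟩ := h.out
  exact ⟨φ.relabel c, fun v => by rw [Language.Formula.realize_relabel, hφ]; rfl⟩

theorem Dfn.exs [Finite κ] {R : (ι → ZFSet.{u}) → (κ → ZFSet.{u}) → Prop}
    (h : Dfn fun w : ι ⊕ κ → ZFSet.{u} => R (fun i => w (.inl i)) fun k => w (.inr k)) :
    Dfn fun v => ∃ x, R v x := by
  let _ := memStructure (fun x y : ZFSet.{u} => x ∈ y)
  obtain ⟨φ, hφ⟩ := h.out
  exact ⟨φ.iExs κ, fun v => by simp [Language.Formula.realize_iExs, hφ]⟩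

/-- With the bound variable stored at `none`, each quantifier adds one `Option` to the index type,
so instance search can follow the shape of a formula through nested quantifiers. -/
instance Dfn.ex {R : (ι → ZFSet.{u}) → ZFSet.{u} → Prop}
    [h : Dfn fun w : Option ι → ZFSet.{u} => R (fun i => w (some i)) (w none)] :
    Dfn fun v => ∃ x, R v x := by
  have := h.comp (κ := ι ⊕ Unit) fun o => o.elim (.inr ()) .inl
  exact (Dfn.exs (κ := Unit) (R := fun v x => R v (x ())) this).congr fun v =>
    ⟨fun ⟨x, hx⟩ => ⟨_, hx⟩, fun ⟨x, hx⟩ => ⟨fun _ => x, hx⟩⟩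

instance Dfn.all {R : (ι → ZFSet.{u}) → ZFSet.{u} → Prop}
    [h : Dfn fun w : Option ι → ZFSet.{u} => R (fun i => w (some i)) (w none)] :
    Dfn fun v => ∀ x, R v x :=
  haveI : Dfn fun w : Option ι → ZFSet.{u} => ¬ R (fun i => w (some i)) (w none) := Dfn.not
  (Dfn.not (P := fun v => ∃ x, ¬ R v x)).congr fun v => by simp

theorem Dfn.forall_finite [Finite κ] {R : κ → (ι → ZFSet.{u}) → Prop} (h : ∀ k, Dfn (R k)) :
    Dfn fun v => ∀ k, R k v := by
  let _ := memStructure (fun x y : ZFSet.{u} => x ∈ y)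
  choose φ hφ using fun k => (h k).out
  exact ⟨.iInf φ, fun v => by simp [Language.Formula.realize_iInf, hφ]⟩

theorem DFun.comp (h : DFun f) (c : ι → κ) : DFun fun v : κ → ZFSet.{u} => f fun i => v (c i) :=
  ⟨h.out.comp (Option.map c)⟩

instance DFun.var (i : ι) : DFun fun v : ι → ZFSet.{u} => v i := ⟨dfn_eq_var none (some i)⟩

/-- Substitution of definable functions into a definable relation. -/
theorem Dfn.subst [Finite κ] {Q : (κ → ZFSet.{u}) → Prop} (hQ : Dfn Q)
    {f : κ → (ι → ZFSet.{u}) → ZFSet.{u}} (hf : ∀ k, DFun (f k)) :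
    Dfn fun v => Q fun k => f k v := by
  have h1 : Dfn fun w : ι ⊕ κ → ZFSet.{u} => Q fun k => w (.inr k) := hQ.comp _
  have h2 : Dfn fun w : ι ⊕ κ → ZFSet.{u} => ∀ k, w (.inr k) = f k fun i => w (.inl i) :=
    Dfn.forall_finite fun k => (hf k).out.comp (κ := ι ⊕ κ) fun o => o.elim (.inr k) .inl
  exact (Dfn.exs (R := fun v x => (∀ k, x k = f k v) ∧ Q x) Dfn.and).congr fun v =>
    ⟨fun ⟨x, hx, hQ⟩ => by rwa [← funext hx], fun h => ⟨_, fun _ => rfl, h⟩⟩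

theorem Dfn.subst₁ {Q : ZFSet.{u} → Prop} (hQ : Dfn fun v : Fin 1 → ZFSet.{u} => Q (v 0))
    {f : (ι → ZFSet.{u}) → ZFSet.{u}} (hf : DFun f) : Dfn fun v => Q (f v) :=
  hQ.subst (f := fun _ => f) fun _ => hf

theorem Dfn.subst₂ {Q : ZFSet.{u} → ZFSet.{u} → Prop}
    (hQ : Dfn fun v : Fin 2 → ZFSet.{u} => Q (v 0) (v 1))
    {f g : (ι → ZFSet.{u}) → ZFSet.{u}} (hf : DFun f) (hg : DFun g) :
    Dfn fun v => Q (f v) (g v) :=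
  hQ.subst (f := ![f, g]) (by simp [Fin.forall_fin_succ, hf, hg])

theorem Dfn.subst₃ {Q : ZFSet.{u} → ZFSet.{u} → ZFSet.{u} → Prop}
    (hQ : Dfn fun v : Fin 3 → ZFSet.{u} => Q (v 0) (v 1) (v 2))
    {f g h : (ι → ZFSet.{u}) → ZFSet.{u}} (hf : DFun f) (hg : DFun g) (hh : DFun h) :
    Dfn fun v => Q (f v) (g v) (h v) :=
  hQ.subst (f := ![f, g, h]) (by simp [Fin.forall_fin_succ, hf, hg, hh])

theorem Dfn.subst₄ {Q : ZFSet.{u} → ZFSet.{u} → ZFSet.{u} → ZFSet.{u} → Prop}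
    (hQ : Dfn fun v : Fin 4 → ZFSet.{u} => Q (v 0) (v 1) (v 2) (v 3))
    {f g h k : (ι → ZFSet.{u}) → ZFSet.{u}} (hf : DFun f) (hg : DFun g) (hh : DFun h)
    (hk : DFun k) : Dfn fun v => Q (f v) (g v) (h v) (k v) :=
  hQ.subst (f := ![f, g, h, k]) (by simp [Fin.forall_fin_succ, hf, hg, hh, hk])

instance Dfn.mem [hf : DFun f] [hg : DFun g] : Dfn fun v => f v ∈ g v :=
  (dfn_mem_var 0 1).subst₂ (Q := fun x y => x ∈ y) hf hg

instance Dfn.eq [hf : DFun f] [hg : DFun g] : Dfn fun v => f v = g v :=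
  (dfn_eq_var 0 1).subst₂ (Q := fun x y => x = y) hf hg

/-- By extensionality, a graph is definable as soon as membership in the values is. -/
theorem DFun.of_mem_iff {f : (ι → ZFSet.{u}) → ZFSet.{u}}
    {R : ZFSet.{u} → (ι → ZFSet.{u}) → Prop} (hf : ∀ v x, x ∈ f v ↔ R x v)
    [h : Dfn fun v : Option ι → ZFSet.{u} => R (v none) fun i => v (some i)] : DFun f := by
  have h' := h.comp (κ := Option (Option ι)) fun o => o.elim none fun i => some (some i)
  have : Dfn fun w : Option (Option ι) → ZFSet.{u} =>
      w none ∈ w (some none) ↔ R (w none) fun i => w (some (some i)) := Dfn.iff (hQ := h')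
  exact ⟨(Dfn.all (R := fun (v : Option ι → ZFSet.{u}) x =>
    x ∈ v none ↔ R x fun i => v (some i))).congr fun v => by simp only [ZFSet.ext_iff, hf]⟩

theorem DFun.subst₂ {F : ZFSet.{u} → ZFSet.{u} → ZFSet.{u}}
    (hF : DFun fun v : Fin 2 → ZFSet.{u} => F (v 0) (v 1))
    (hf : DFun f) (hg : DFun g) : DFun fun v => F (f v) (g v) :=
  ⟨hF.out.subst (f := fun o v => o.elim (v none) fun j => ![f, g] j fun i => v (some i))
    (Option.rec (DFun.var none) fun j => DFun.comp (by fin_cases j <;> assumption) some)⟩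

theorem DFun.subst₃ {F : ZFSet.{u} → ZFSet.{u} → ZFSet.{u} → ZFSet.{u}}
    (hF : DFun fun v : Fin 3 → ZFSet.{u} => F (v 0) (v 1) (v 2)) {h : (ι → ZFSet.{u}) → ZFSet.{u}}
    (hf : DFun f) (hg : DFun g) (hh : DFun h) : DFun fun v => F (f v) (g v) (h v) :=
  ⟨hF.out.subst (f := fun o v => o.elim (v none) fun j => ![f, g, h] j fun i => v (some i))
    (Option.rec (DFun.var none) fun j => DFun.comp (by fin_cases j <;> assumption) some)⟩

instance DFun.empty : DFun fun _ : ι → ZFSet.{u} => ∅ :=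
  .of_mem_iff (R := fun _ _ => False) (by simp)

instance DFun.insert [hf : DFun f] [hg : DFun g] : DFun fun v => insert (f v) (g v) :=
  .subst₂ (F := fun x y => Insert.insert x y)
    (.of_mem_iff (R := fun x v => x = v 0 ∨ x ∈ v 1) (by simp)) hf hg

instance DFun.pair [hf : DFun f] [hg : DFun g] : DFun fun v => ZFSet.pair (f v) (g v) :=
  (inferInstance : DFun fun v => {{f v}, {f v, g v}})

instance Dfn.subset [hf : DFun f] [hg : DFun g] : Dfn fun v => f v ⊆ g v :=
  .subst₂ (Q := fun x y => x ⊆ y)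
    ((inferInstance : Dfn fun v : Fin 2 → ZFSet.{u} => ∀ x, x ∈ v 0 → x ∈ v 1).congr
      fun _ => by simp [ZFSet.subset_def]) hf hg

instance Dfn.isOrdinal [hf : DFun f] : Dfn fun v => (f v).IsOrdinal :=
  .subst₁ ((inferInstance : Dfn fun v : Fin 1 → ZFSet.{u} => (∀ y, y ∈ v 0 → y ⊆ v 0) ∧
      ∀ y z w, y ∈ z → z ∈ w → w ∈ v 0 → y ∈ w).congr fun _ =>
        ⟨fun h => ⟨h.1, h.2 _ _ _⟩, fun h => ⟨h.1, fun _ _ _ => h.2⟩⟩) hf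

end Framework

/-! ### Definable closure -/

/-- The definable closure of `B`: the sets that are definable in the universe from finitely many
parameters in `B`. -/
def dcl (B : Set ZFSet.{u}) : Set ZFSet.{u} :=
  {a | ∃ (ι : Type) (_ : Finite ι) (R : (ι → ZFSet.{u}) → ZFSet.{u} → Prop) (p : ι → ZFSet.{u}),
    (Dfn fun v : Option ι → ZFSet.{u} => R (fun i => v (some i)) (v none)) ∧
    (∀ i, p i ∈ B) ∧ ∀ x, R p x ↔ x = a}

section DefinableClosure

variable {A B : Set ZFSet.{u}}

theorem subset_dcl : B ⊆ dcl B := fun a ha =>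
  ⟨Unit, inferInstance, fun p x => x = p (), fun _ => a, inferInstance, fun _ => ha,
    fun _ => Iff.rfl⟩

theorem dcl_mono (h : A ⊆ B) : dcl A ⊆ dcl B := fun _ ⟨ι, hι, R, p, hR, hp, hx⟩ =>
  ⟨ι, hι, R, p, hR, fun i => h (hp i), hx⟩

/-- The definitions of the parameters are substituted into the definition of `a`; the new parameters
are indexed by `Σ i, κ i`. -/
theorem dcl_dcl : dcl (dcl B) ⊆ dcl B := by
  rintro a ⟨ι, hι, R, p, hR, hp, hx⟩
  choose κ hκ S q hS hq hpq using hp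
  refine ⟨Σ i, κ i, inferInstance, fun w x => ∃ y : ι → ZFSet.{u},
    (∀ i, S i (fun k => w ⟨i, k⟩) (y i)) ∧ R y x, fun j => q j.1 j.2, ?_, fun j => hq _ _, ?_⟩
  · refine Dfn.exs ?_
    have h1 := hR.comp (κ := Option (Σ i, κ i) ⊕ ι) fun o => o.elim (.inl none) .inr
    have h2 : Dfn fun w : Option (Σ i, κ i) ⊕ ι → ZFSet.{u} =>
        ∀ i, S i (fun k => w (.inl (some ⟨i, k⟩))) (w (.inr i)) :=
      Dfn.forall_finite fun i => (hS i).comp (κ := Option (Σ i, κ i) ⊕ ι)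
        fun o => o.elim (.inr i) fun k => .inl (some ⟨i, k⟩)
    exact Dfn.and (hP := h2) (hQ := h1)
  · intro x
    constructor
    · rintro ⟨y, hy, hR⟩
      rw [← hx, show p = y from funext fun i => ((hpq i _).1 (hy i)).symm]
      exact hR
    · intro h
      exact ⟨p, fun i => (hpq i _).2 rfl, (hx x).2 h⟩

theorem dcl_subset_dcl (h : A ⊆ dcl B) : dcl A ⊆ dcl B := (dcl_mono h).trans dcl_dcl

theorem mem_dcl_of_dfn {ι : Type} [Finite ι] {R : (ι → ZFSet.{u}) → ZFSet.{u} → Prop}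
    (hR : Dfn fun v : Option ι → ZFSet.{u} => R (fun i => v (some i)) (v none))
    {p : ι → ZFSet.{u}} (hp : ∀ i, p i ∈ dcl B) {a : ZFSet.{u}} (ha : R p a)
    (huniq : ∀ x, R p x → x = a) : a ∈ dcl B :=
  dcl_dcl ⟨ι, ‹_›, R, p, hR, hp, fun x => ⟨huniq x, fun h => h ▸ ha⟩⟩

theorem DFun.mem_dcl {ι : Type} [Finite ι] {F : (ι → ZFSet.{u}) → ZFSet.{u}} (hF : DFun F)
    {p : ι → ZFSet.{u}} (hp : ∀ i, p i ∈ dcl B) : F p ∈ dcl B :=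
  mem_dcl_of_dfn (R := fun p x => x = F p) hF.out hp rfl fun _ => id

/-- A formula mentions only finitely many parameters. Turning these constants into explicit
variables gives a form in which parameters can be substituted and quantified. -/
theorem OD_eq_dcl (X : Set ZFSet.{u}) : OD X = dcl ({x | x.IsOrdinal} ∪ X) := by
  let _ := memStructure (fun x y : ZFSet.{u} => x ∈ y)
  ext a
  constructor
  · intro h
    obtain ⟨A, hA, hdef⟩ := Set.definable_iff_finitely_definable.1 h
    obtain ⟨φ, hφ⟩ := Set.definable_iff_exists_formula_sum.1 hdef
    let e := A.equivFin
    let c : A ⊕ Fin 1 → Option (Fin A.card) := Sum.elim (fun x => some (e x)) fun _ => none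
    refine ⟨Fin A.card, inferInstance,
      fun p x => φ.Realize fun i => (c i).elim x p, fun i => (e.symm i : ZFSet.{u}),
      ⟨φ.relabel c, fun v => ?_⟩, fun i => hA (e.symm i).2, fun x => ?_⟩
    · rw [Language.Formula.realize_relabel]
      refine iff_of_eq (congrArg _ (funext fun i => ?_))
      rcases i with i | i <;> rfl
    · have := Set.ext_iff.1 hφ fun _ => x
      refine Iff.trans (iff_of_eq (congrArg _ (funext fun i => ?_))) this.symm
      rcases i with i | i
      · simp [c]
      · rfl
  · rintro ⟨ι, _, R, p, ⟨φ, hφ⟩, hp, hx⟩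
    refine Set.definable_iff_exists_formula_sum.2
      ⟨φ.relabel fun o => o.elim (.inr 0) fun i => .inl ⟨p i, hp i⟩, ?_⟩
    ext v
    refine Iff.trans ?_ (Language.Formula.realize_relabel.trans (hφ _)).symm
    exact (hx (v 0)).symm

/-- Definable choice of ordinals: a nonempty definable relation on ordinals has an instance
consisting of definable ordinals. -/
theorem exists_ordinals_mem_dcl (n : ℕ) : ∀ {ι : Type} [Finite ι]
    (Q : (ι → ZFSet.{u}) → (Fin n → ZFSet.{u}) → Prop),
    (Dfn fun w : ι ⊕ Fin n → ZFSet.{u} => Q (fun i => w (.inl i)) fun k => w (.inr k)) →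
    ∀ p : ι → ZFSet.{u}, (∀ i, p i ∈ dcl B) →
    (∃ α : Fin n → ZFSet.{u}, (∀ k, (α k).IsOrdinal) ∧ Q p α) →
    ∃ α : Fin n → ZFSet.{u}, (∀ k, α k ∈ dcl B) ∧ Q p α := by
  induction n with
  | zero =>
    rintro ι _ Q hQ p hp ⟨α, -, h⟩
    exact ⟨α, fun k => k.elim0, h⟩
  | succ n ih =>
    rintro ι _ Q hQ p hp ⟨α, hα, h⟩
    -- The least solution of `S` is definable from `p`; it then becomes a further parameter for the
    -- remaining coordinates.
    let S : (ι → ZFSet.{u}) → ZFSet.{u} → Prop := fun p x => x.IsOrdinal ∧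
      ∃ β : Fin n → ZFSet.{u}, (∀ k, (β k).IsOrdinal) ∧ Q p (Fin.cons x β)
    have hS : Dfn fun v : Option ι → ZFSet.{u} => S (fun i => v (some i)) (v none) := by
      have h1 := hQ.comp (κ := Option ι ⊕ Fin n) (Sum.elim (fun i => .inl (some i))
        (Fin.cons (.inl none) .inr))
      have h2 : Dfn fun w : Option ι ⊕ Fin n → ZFSet.{u} => ∀ k, (w (.inr k)).IsOrdinal :=
        Dfn.forall_finite fun k => inferInstance
      have h3 := Dfn.exs (ι := Option ι) (κ := Fin n) (R := fun v β => (∀ k, (β k).IsOrdinal) ∧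
        Q (fun i => v (some i)) (Fin.cons (v none) β)) ((Dfn.and (hP := h2) (hQ := h1)).congr
          fun v => and_congr Iff.rfl (iff_of_eq (congrArg _ (funext fun k => by
            refine Fin.cases ?_ (fun k => ?_) k <;> rfl))))
      exact Dfn.and (hQ := h3)
    obtain ⟨x, hx, hmin⟩ := ZFSet.mem_wf.has_min {x | S p x}
      ⟨α 0, hα 0, Fin.tail α, fun k => hα k.succ, by rwa [Fin.cons_self_tail]⟩
    have hxB : x ∈ dcl B := by
      refine mem_dcl_of_dfn (R := fun p x => S p x ∧ ∀ y, y ∈ x → ¬ S p y) ?_ hp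
        ⟨hx, fun y hyx hy => hmin y hy hyx⟩ fun y ⟨hy, hymin⟩ => ?_
      · have h1 := hS.comp (κ := Option (Option ι)) fun o => o.elim none fun i => some (some i)
        have h2 : Dfn fun w : Option (Option ι) → ZFSet.{u} =>
            w none ∈ w (some none) → ¬ S (fun i => w (some (some i))) (w none) :=
          Dfn.imp (hQ := Dfn.not (hP := h1))
        exact Dfn.and (hP := hS) (hQ := Dfn.all (R := fun (v : Option ι → ZFSet.{u}) y =>
          y ∈ v none → ¬ S (fun i => v (some i)) y))
      · rcases hx.1.mem_trichotomous hy.1 with h | h | h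
        · exact absurd hx (hymin x h)
        · exact h.symm
        · exact absurd h (hmin y hy)
    obtain ⟨β, hβ, hQβ⟩ := ih (ι := Option ι)
      (fun p β => Q (fun i => p (some i)) (Fin.cons (p none) β))
      ((hQ.comp (κ := Option ι ⊕ Fin n) (Sum.elim (fun i => .inl (some i))
        (Fin.cons (.inl none) .inr))).congr fun v =>
          iff_of_eq (congrArg _ (funext fun k => by refine Fin.cases ?_ (fun k => ?_) k <;> rfl)))
      (fun o => o.elim x p) (Option.rec hxB hp) hx.2
    exact ⟨Fin.cons x β, Fin.cases hxB hβ, hQβ⟩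

end DefinableClosure

/-! ### Natural numbers and sequences as sets -/

/-- The natural number `n` as a von Neumann ordinal. -/
noncomputable def nat (n : ℕ) : ZFSet.{u} := (n : Ordinal.{u}).toZFSet

/-- The function on `ω` with values `g n`, as a set. -/
noncomputable def seq (g : ℕ → ZFSet.{u}) : ZFSet.{u} :=
  ZFSet.range fun n => ZFSet.pair (nat n) (g n)

/-- The value of the function `f` at `x`. -/
noncomputable def app (f x : ZFSet.{u}) : ZFSet.{u} :=
  ((f.sUnion.sUnion).sep fun y => ZFSet.pair x y ∈ f).sUnion

/-- Cantor's enumeration of `ℕ × ℕ` along the diagonals. -/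
def walk : ℕ → ℕ × ℕ
  | 0 => (0, 0)
  | n + 1 => match walk n with
    | (0, b) => (b + 1, 0)
    | (a + 1, b) => (a, b + 1)

/-- The graph of `walk` on sets. -/
def IsWalk (x y z : ZFSet.{u}) : Prop :=
  ∃ n, x = nat n ∧ y = nat (walk n).1 ∧ z = nat (walk n).2

/-- The `x`-th row of the sequence `s`, when the positions of `s` are arranged by `walk`. -/
noncomputable def row (s x : ZFSet.{u}) : ZFSet.{u} :=
  (ZFSet.prod ZFSet.omega s.sUnion.sUnion).sep fun p =>
    ∃ k m z, IsWalk m x k ∧ ZFSet.pair m z ∈ s ∧ p = ZFSet.pair k z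

/-- The sequence with given rows. -/
noncomputable def join (F : ℕ → ℕ → ZFSet.{u}) : ZFSet.{u} :=
  seq fun m => F (walk m).1 (walk m).2

theorem nat_zero : nat.{u} 0 = ∅ := by simp [nat]

theorem nat_succ (n : ℕ) : nat.{u} (n + 1) = insert (nat n) (nat n) := by
  simp [nat, Ordinal.toZFSet_add_one]

@[simp] theorem nat_mem_nat {m n : ℕ} : nat.{u} m ∈ nat n ↔ m < n := by
  simp [nat, Ordinal.toZFSet_mem_toZFSet_iff]

@[simp] theorem nat_inj {m n : ℕ} : nat.{u} m = nat n ↔ m = n := by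
  simp [nat, Ordinal.toZFSet_injective.eq_iff]

theorem isOrdinal_nat (n : ℕ) : (nat.{u} n).IsOrdinal := ZFSet.isOrdinal_toZFSet _

theorem mem_omega_iff {x : ZFSet.{u}} : x ∈ ZFSet.omega ↔ ∃ n, x = nat n := by
  have key : ∀ n, ZFSet.mk (PSet.ofNat n) = nat.{u} n := by
    intro n
    induction n with
    | zero => rw [nat_zero]; rfl
    | succ n ih => rw [nat_succ, ← ih]; rfl
  constructor
  · refine Quotient.inductionOn x fun y => ?_
    rintro ⟨⟨n⟩, h⟩
    exact ⟨n, (ZFSet.sound h).trans (key n)⟩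
  · rintro ⟨n, rfl⟩
    rw [← key]
    exact ⟨⟨n⟩, PSet.Equiv.rfl⟩

@[simp] theorem nat_mem_omega (n : ℕ) : nat.{u} n ∈ ZFSet.omega := mem_omega_iff.2 ⟨n, rfl⟩

theorem exists_nat_of_mem_nat {x : ZFSet.{u}} {n : ℕ} (h : x ∈ nat n) : ∃ m, x = nat m := by
  induction n with
  | zero => simp [nat_zero] at h
  | succ n ih =>
    rw [nat_succ, ZFSet.mem_insert_iff] at h
    rcases h with h | h
    · exact ⟨n, h⟩
    · exact ih h

theorem insert_self_inj {a b : ZFSet.{u}} (h : insert a a = insert b b) : a = b := by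
  have h1 : a ∈ insert b b := h ▸ ZFSet.mem_insert a a
  have h2 : b ∈ insert a a := h ▸ ZFSet.mem_insert b b
  rw [ZFSet.mem_insert_iff] at h1 h2
  rcases h1 with h1 | h1
  · exact h1
  · rcases h2 with h2 | h2
    · exact h2.symm
    · exact absurd h2 (ZFSet.mem_asymm h1)

theorem insert_self_eq_nat {a : ZFSet.{u}} {n : ℕ} (h : insert a a = nat n) :
    ∃ m, n = m + 1 ∧ a = nat m := by
  cases n with
  | zero => exact absurd (ZFSet.mem_insert a a) (by simp [h, nat_zero])
  | succ n => exact ⟨n, rfl, insert_self_inj (h.trans (nat_succ n))⟩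

/-! ### Functions on `ω` as sets, and their coding by rows -/

theorem mem_seq {g : ℕ → ZFSet.{u}} {p : ZFSet.{u}} :
    p ∈ seq g ↔ ∃ n, p = ZFSet.pair (nat n) (g n) := by
  simp [seq, eq_comm]

@[simp] theorem pair_mem_seq {g : ℕ → ZFSet.{u}} {n : ℕ} {y : ZFSet.{u}} :
    ZFSet.pair (nat n) y ∈ seq g ↔ y = g n := by
  simp only [mem_seq, ZFSet.pair_inj, nat_inj]
  exact ⟨fun ⟨m, h, h'⟩ => h ▸ h', fun h => ⟨n, rfl, h⟩⟩

theorem mem_sUnion_of_pair_mem {x y f : ZFSet.{u}} (h : ZFSet.pair x y ∈ f) :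
    y ∈ f.sUnion.sUnion :=
  ZFSet.mem_sUnion_of_mem (z := ({x, y} : ZFSet.{u})) (by simp)
    (ZFSet.mem_sUnion_of_mem (by simp [ZFSet.pair]) h)

theorem mem_app {f x z : ZFSet.{u}} : z ∈ app f x ↔ ∃ y, ZFSet.pair x y ∈ f ∧ z ∈ y := by
  rw [app, ZFSet.mem_sUnion]
  exact ⟨fun ⟨y, h, hz⟩ => ⟨y, (ZFSet.mem_sep.1 h).2, hz⟩,
    fun ⟨y, h, hz⟩ => ⟨y, ZFSet.mem_sep.2 ⟨mem_sUnion_of_pair_mem h, h⟩, hz⟩⟩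

@[simp] theorem app_seq (g : ℕ → ZFSet.{u}) (n : ℕ) : app (seq g) (nat n) = g n := by
  ext z
  simp [mem_app]

theorem seq_injective : Function.Injective seq.{u} := fun g g' h => by
  ext1 n
  rw [← app_seq g, h, app_seq]

theorem isFunc_omega_iff {U f : ZFSet.{u}} :
    ZFSet.IsFunc ZFSet.omega U f ↔ ∃ g, (∀ n, g n ∈ U) ∧ f = seq g := by
  constructor
  · rintro ⟨h1, h2⟩
    choose g hg hg' using fun n => h2 (nat n) (nat_mem_omega n)
    refine ⟨g, fun n => (ZFSet.pair_mem_prod.1 (h1 (hg n))).2, ?_⟩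
    ext p
    rw [mem_seq]
    constructor
    · intro hp
      obtain ⟨x, hx, y, hy, rfl⟩ := ZFSet.mem_prod.1 (h1 hp)
      obtain ⟨n, rfl⟩ := mem_omega_iff.1 hx
      exact ⟨n, by rw [hg' n y hp]⟩
    · rintro ⟨n, rfl⟩
      exact hg n
  · rintro ⟨g, hg, rfl⟩
    constructor
    · intro p hp
      obtain ⟨n, rfl⟩ := mem_seq.1 hp
      exact ZFSet.pair_mem_prod.2 ⟨nat_mem_omega n, hg n⟩
    · intro x hx
      obtain ⟨n, rfl⟩ := mem_omega_iff.1 hx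
      simp

theorem mem_omegaSeq {M : Set ZFSet.{u}} {f : ZFSet.{u}} :
    f ∈ omegaSeq M ↔ ∃ g, (∀ n, g n ∈ M) ∧ f = seq g := by
  constructor
  · rintro ⟨y, hy, hf⟩
    obtain ⟨g, hg, rfl⟩ := isFunc_omega_iff.1 hf
    exact ⟨g, fun n => hy _ (hg n), rfl⟩
  · rintro ⟨g, hg, rfl⟩
    exact ⟨ZFSet.range g, by simpa using hg, isFunc_omega_iff.2 ⟨g, by simp, rfl⟩⟩

theorem walk_surjective : Function.Surjective walk := by
  have key : ∀ s b, b ≤ s → ∃ n, walk n = (s - b, b) := by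
    intro s
    induction s with
    | zero =>
      intro b hb
      obtain rfl := Nat.le_zero.1 hb
      exact ⟨0, rfl⟩
    | succ s ihs =>
      intro b
      induction b with
      | zero =>
        intro _
        -- The diagonal of sum `s` ends at `(0, s)`, from where `walk` jumps to `(s + 1, 0)`.
        obtain ⟨n, hn⟩ := ihs s le_rfl
        exact ⟨n + 1, by simp [walk, hn]⟩
      | succ b ihb =>
        intro hb
        obtain ⟨n, hn⟩ := ihb (by omega)
        rw [show s + 1 - b = s - b + 1 by omega] at hn
        exact ⟨n + 1, by simp [walk, hn]⟩
  rintro ⟨a, b⟩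
  obtain ⟨n, hn⟩ := key (a + b) b (by omega)
  exact ⟨n, by simpa using hn⟩

theorem mem_row {s x p : ZFSet.{u}} :
    p ∈ row s x ↔ ∃ k m z, IsWalk m x k ∧ ZFSet.pair m z ∈ s ∧ p = ZFSet.pair k z := by
  rw [row, ZFSet.mem_sep, and_iff_right_iff_imp]
  rintro ⟨k, m, z, ⟨n, -, -, rfl⟩, h, rfl⟩
  exact ZFSet.pair_mem_prod.2 ⟨nat_mem_omega _, mem_sUnion_of_pair_mem h⟩

@[simp] theorem row_join (F : ℕ → ℕ → ZFSet.{u}) (n : ℕ) : row (join F) (nat n) = seq (F n) := by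
  ext p
  rw [mem_row, mem_seq]
  constructor
  · rintro ⟨k, m, z, ⟨i, rfl, hn, rfl⟩, h, rfl⟩
    rw [join, pair_mem_seq, ← nat_inj.1 hn] at h
    exact ⟨_, by rw [h]⟩
  · rintro ⟨k, rfl⟩
    obtain ⟨m, hm⟩ := walk_surjective (n, k)
    exact ⟨nat k, nat m, F n k, ⟨m, rfl, by rw [hm], by rw [hm]⟩, by simp [join, hm], rfl⟩

theorem join_mem_omegaSeq {M : Set ZFSet.{u}} {F : ℕ → ℕ → ZFSet.{u}} (h : ∀ n k, F n k ∈ M) :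
    join F ∈ omegaSeq M := mem_omegaSeq.2 ⟨_, fun _ => h _ _, rfl⟩

/-! ### Definability of the coding operations and of the von Neumann hierarchy -/

section Definability

variable {ι : Type} {f g h : (ι → ZFSet.{u}) → ZFSet.{u}}

instance dfun_omega : DFun fun _ : ι → ZFSet.{u} => ZFSet.omega := by
  refine .of_mem_iff (R := fun x _ => ∀ h, ∅ ∈ h → (∀ k, k ∈ h → insert k k ∈ h) → x ∈ h)
    fun _ x => ⟨fun hx h h0 hs => ?_, fun h => h _ ZFSet.omega_zero fun _ => ZFSet.omega_succ⟩
  obtain ⟨n, rfl⟩ := mem_omega_iff.1 hx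
  induction n with
  | zero => rwa [nat_zero]
  | succ n ih => rw [nat_succ]; exact hs _ (ih (nat_mem_omega n))

instance dfun_app [hf : DFun f] [hg : DFun g] : DFun fun v => app (f v) (g v) :=
  .subst₂ (F := app) (.of_mem_iff
    (R := fun z v => ∃ y, ZFSet.pair (v 1) y ∈ v 0 ∧ z ∈ y) fun _ _ => mem_app) hf hg

/-- The graph is the least set containing the start and closed under the recursion clauses, so
quantifying over all such `h` makes the recursion first-order. In the converse direction `h` is
taken to be the graph itself. -/
theorem isWalk_iff {x y z : ZFSet.{u}} : IsWalk x y z ↔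
    ∀ h : ZFSet.{u}, ZFSet.pair ∅ (ZFSet.pair ∅ ∅) ∈ h →
      (∀ n b, ZFSet.pair n (ZFSet.pair ∅ b) ∈ h →
        ZFSet.pair (insert n n) (ZFSet.pair (insert b b) ∅) ∈ h) →
      (∀ n a b, ZFSet.pair n (ZFSet.pair (insert a a) b) ∈ h →
        ZFSet.pair (insert n n) (ZFSet.pair a (insert b b)) ∈ h) →
      ZFSet.pair x (ZFSet.pair y z) ∈ h := by
  constructor
  · rintro ⟨n, rfl, rfl, rfl⟩ h h0 h1 h2
    induction n with
    | zero => simpa [walk, nat_zero] using h0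
    | succ n ih =>
      rcases hw : walk n with ⟨_ | a, b⟩
      · rw [hw, nat_zero] at ih
        have := h1 _ _ ih
        rw [← nat_succ, ← nat_succ] at this
        simpa [walk, hw, nat_zero] using this
      · rw [hw, nat_succ] at ih
        have := h2 _ _ _ ih
        rw [← nat_succ, ← nat_succ] at this
        simpa [walk, hw] using this
  · intro H
    have hmem : ∀ {x y z}, ZFSet.pair x (ZFSet.pair y z) ∈ ZFSet.range (fun n =>
        ZFSet.pair (nat.{u} n) (ZFSet.pair (nat (walk n).1) (nat (walk n).2))) ↔ IsWalk x y z := by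
      intro x y z
      simp only [ZFSet.mem_range, ZFSet.pair_inj, IsWalk, eq_comm]
    refine hmem.1 (H _ (hmem.2 ⟨0, ?_⟩) ?_ ?_)
    · simp [walk, nat_zero]
    · intro n b h
      obtain ⟨m, rfl, h1, rfl⟩ := hmem.1 h
      rw [← nat_zero, nat_inj] at h1
      refine hmem.2 ⟨m + 1, (nat_succ m).symm, ?_⟩
      rcases hw : walk m with ⟨a, b⟩
      obtain rfl : 0 = a := by rw [h1, hw]
      simp [walk, hw, nat_succ, nat_zero]
    · intro n a b h
      obtain ⟨m, rfl, h1, rfl⟩ := hmem.1 h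
      obtain ⟨a, ha, rfl⟩ := insert_self_eq_nat h1
      refine hmem.2 ⟨m + 1, (nat_succ m).symm, ?_⟩
      rcases hw : walk m with ⟨a', b⟩
      obtain rfl : a + 1 = a' := by rw [← ha, hw]
      simp [walk, hw, nat_succ]

instance dfn_isWalk [hf : DFun f] [hg : DFun g] [hh : DFun h] :
    Dfn fun v => IsWalk (f v) (g v) (h v) :=
  .subst₃ (Q := IsWalk) (Dfn.congr (P := fun v => ∀ h, ZFSet.pair ∅ (ZFSet.pair ∅ ∅) ∈ h →
      (∀ n b, ZFSet.pair n (ZFSet.pair ∅ b) ∈ h →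
        ZFSet.pair (insert n n) (ZFSet.pair (insert b b) ∅) ∈ h) →
      (∀ n a b, ZFSet.pair n (ZFSet.pair (insert a a) b) ∈ h →
        ZFSet.pair (insert n n) (ZFSet.pair a (insert b b)) ∈ h) →
      ZFSet.pair (v 0) (ZFSet.pair (v 1) (v 2)) ∈ h) inferInstance
      fun _ => isWalk_iff.symm) hf hg hh

instance dfun_row [hf : DFun f] [hg : DFun g] : DFun fun v => row (f v) (g v) :=
  .subst₂ (F := row) (.of_mem_iff
    (R := fun p v => ∃ k m z, IsWalk m (v 1) k ∧ ZFSet.pair m z ∈ v 0 ∧ p = ZFSet.pair k z)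
    fun _ _ => mem_row) hf hg

instance dfn_isFunc [hf : DFun f] [hg : DFun g] [hh : DFun h] :
    Dfn fun v => ZFSet.IsFunc (f v) (g v) (h v) :=
  .subst₃ (Q := ZFSet.IsFunc) (Dfn.congr (P := fun v : Fin 3 → ZFSet.{u} =>
    (∀ p, p ∈ v 2 → ∃ x, x ∈ v 0 ∧ ∃ y, y ∈ v 1 ∧ p = ZFSet.pair x y) ∧
      ∀ x, x ∈ v 0 → ∃ y, ZFSet.pair x y ∈ v 2 ∧ ∀ z, ZFSet.pair x z ∈ v 2 → z = y) inferInstance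
    fun v => and_congr (by simp [ZFSet.subset_def]) Iff.rfl) hf hg hh

/-- `U` is a stage of the von Neumann hierarchy. -/
def IsLevel (U : ZFSet.{u}) : Prop := ∃ o, U = ZFSet.vonNeumann o

/-- A stage consists of the subsets of earlier stages, so by `∈`-induction `v` must be the stage
with index `v.rank`. -/
theorem isLevel_of_history {h : ZFSet.{u}}
    (hh : ∀ v ∈ h, ∀ x, x ∈ v ↔ ∃ w ∈ h, w ∈ v ∧ x ⊆ w) {v : ZFSet.{u}} : v ∈ h → IsLevel v := by
  induction v using ZFSet.inductionOn with
  | _ v ih =>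
    intro hv
    refine ⟨v.rank, ?_⟩
    ext x
    constructor
    · intro hx
      exact ZFSet.mem_vonNeumann.2 (ZFSet.rank_lt_of_mem hx)
    · intro hx
      rw [ZFSet.mem_vonNeumann, ZFSet.lt_rank_iff] at hx
      obtain ⟨z, hz, hxz⟩ := hx
      obtain ⟨w, hw, hwv, hzw⟩ := (hh v hv z).1 hz
      obtain ⟨o, rfl⟩ := ih w hwv hw
      exact (hh v hv x).2 ⟨_, hw, hwv,
        ZFSet.subset_vonNeumann.2 (hxz.trans (ZFSet.subset_vonNeumann.1 hzw))⟩

/-- The transfinite recursion is replaced by the existence of one set `h` of stages; the witness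
consists of all stages up to `U`. -/
theorem isLevel_iff {U : ZFSet.{u}} : IsLevel U ↔
    ∃ h : ZFSet.{u}, (∀ v, v ∈ h → ∀ x, x ∈ v ↔ ∃ w, w ∈ h ∧ w ∈ v ∧ x ⊆ w) ∧ U ∈ h := by
  constructor
  · rintro ⟨o, rfl⟩
    refine ⟨ZFSet.range fun a : Set.Iic o => ZFSet.vonNeumann a, ?_, by simp⟩
    intro v hv x
    obtain ⟨⟨a, ha⟩, rfl⟩ := ZFSet.mem_range.1 hv
    rw [ZFSet.mem_vonNeumann']
    constructor
    · rintro ⟨b, hb, hx⟩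
      exact ⟨_, ZFSet.mem_range.2 ⟨⟨b, hb.le.trans ha⟩, rfl⟩, by simpa using hb, hx⟩
    · rintro ⟨w, hw, hwv, hx⟩
      obtain ⟨⟨b, hb⟩, rfl⟩ := ZFSet.mem_range.1 hw
      exact ⟨b, by simpa using hwv, hx⟩
  · rintro ⟨h, hh, hU⟩
    exact isLevel_of_history hh hU

instance dfn_isLevel [hf : DFun f] : Dfn fun v => IsLevel (f v) :=
  .subst₁ (Dfn.congr (P := fun v : Fin 1 → ZFSet.{u} =>
    ∃ h : ZFSet.{u}, (∀ v, v ∈ h → ∀ x, x ∈ v ↔ ∃ w, w ∈ h ∧ w ∈ v ∧ x ⊆ w) ∧ v 0 ∈ h)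
    inferInstance fun _ => isLevel_iff.symm) hf

end Definability

/-! ### Satisfaction for formulas coded by natural numbers -/

/-- The principal symbol of the formula coded by `n`. -/
def op (n : ℕ) : ℕ := (walk n).1

/-- The first argument of the principal symbol of the formula coded by `n`. -/
def larg (n : ℕ) : ℕ := (walk (walk n).2).1

/-- The second argument of the principal symbol of the formula coded by `n`. -/
def rarg (n : ℕ) : ℕ := (walk (walk n).2).2

theorem exists_code (o i j : ℕ) : ∃ n, op n = o ∧ larg n = i ∧ rarg n = j := by
  obtain ⟨l, hl⟩ := walk_surjective (i, j)
  obtain ⟨n, hn⟩ := walk_surjective (o, l)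
  exact ⟨n, by simp [op, hn], by simp [larg, hn, hl], by simp [rarg, hn, hl]⟩

/-- Applied twice, this bounds both arguments of a code by the code, strictly if its symbol is
positive; the recursion defining `Sat` terminates for this reason. -/
theorem walk_add_le (n : ℕ) : (walk n).1 + (walk n).2 ≤ n := by
  induction n with
  | zero => simp [walk]
  | succ n ih =>
    rcases hw : walk n with ⟨_ | a, b⟩ <;> simp only [hw] at ih <;> simp only [walk, hw] <;> omega

theorem larg_le (n : ℕ) : larg n ≤ n := by
  have h1 := walk_add_le n
  have h2 := walk_add_le (walk n).2
  unfold larg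
  omega

theorem rarg_le (n : ℕ) : rarg n ≤ n := by
  have h1 := walk_add_le n
  have h2 := walk_add_le (walk n).2
  unfold rarg
  omega

theorem larg_lt {n : ℕ} (h : 0 < op n) : larg n < n := by
  have h1 := walk_add_le n
  have h2 := walk_add_le (walk n).2
  unfold larg
  unfold op at h
  omega

theorem rarg_lt {n : ℕ} (h : 0 < op n) : rarg n < n := by
  have h1 := walk_add_le n
  have h2 := walk_add_le (walk n).2
  unfold rarg
  unfold op at h
  omega

/-- Satisfaction in `(U, ∈)` of the formula coded by `n` under the assignment `g`. -/
def Sat (U : Set ZFSet.{u}) (n : ℕ) (g : ℕ → ZFSet.{u}) : Prop :=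
  if op n = 1 then g (larg n) = g (rarg n)
  else if op n = 2 then g (larg n) ∈ g (rarg n)
  else if _ : op n = 3 then Sat U (larg n) g → Sat U (rarg n) g
  else if _ : op n = 4 then ∀ x ∈ U, Sat U (rarg n) (Function.update g (larg n) x)
  else False
termination_by n
decreasing_by
  · exact larg_lt (by omega)
  · exact rarg_lt (by omega)
  · exact rarg_lt (by omega)

section Sat

variable {U : Set ZFSet.{u}} {n : ℕ} {g : ℕ → ZFSet.{u}}

theorem sat_eq (h : op n = 1) : Sat U n g ↔ g (larg n) = g (rarg n) := by
  rw [Sat]; simp [h]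

theorem sat_mem (h : op n = 2) : Sat U n g ↔ g (larg n) ∈ g (rarg n) := by
  rw [Sat]; simp [h]

theorem sat_imp (h : op n = 3) : Sat U n g ↔ (Sat U (larg n) g → Sat U (rarg n) g) := by
  rw [Sat]; simp [h]

theorem sat_all (h : op n = 4) :
    Sat U n g ↔ ∀ x ∈ U, Sat U (rarg n) (Function.update g (larg n) x) := by
  rw [Sat]; simp [h]

theorem sat_other (h1 : op n ≠ 1) (h2 : op n ≠ 2) (h3 : op n ≠ 3) (h4 : op n ≠ 4) :
    ¬ Sat U n g := by
  rw [Sat]; simp [h1, h2, h3, h4]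

/-- Induction on formulas, for formulas coded by natural numbers. -/
theorem code_induction {P : ℕ → Prop} (heq : ∀ n, op n = 1 → P n) (hmem : ∀ n, op n = 2 → P n)
    (himp : ∀ n, op n = 3 → P (larg n) → P (rarg n) → P n)
    (hall : ∀ n, op n = 4 → P (rarg n) → P n)
    (hother : ∀ n, op n ≠ 1 → op n ≠ 2 → op n ≠ 3 → op n ≠ 4 → P n) (n : ℕ) : P n := by
  induction n using Nat.strong_induction_on with
  | _ n ih =>
    by_cases h1 : op n = 1
    · exact heq n h1
    by_cases h2 : op n = 2
    · exact hmem n h2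
    by_cases h3 : op n = 3
    · exact himp n h3 (ih _ (larg_lt (by omega))) (ih _ (rarg_lt (by omega)))
    by_cases h4 : op n = 4
    · exact hall n h4 (ih _ (rarg_lt (by omega)))
    exact hother n h1 h2 h3 h4

/-- Arguments never exceed their code, so only variables with index at most `n` occur in formula
`n`. An infinite assignment may therefore be altered beyond `n`. -/
theorem sat_congr (n : ℕ) : ∀ (N : ℕ) {g g' : ℕ → ZFSet.{u}}, n ≤ N → (∀ k ≤ N, g k = g' k) →
    (Sat U n g ↔ Sat U n g') := by
  induction n using code_induction with
  | heq n h =>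
    intro N g g' hN hg
    rw [sat_eq h, sat_eq h, hg _ ((larg_le n).trans hN), hg _ ((rarg_le n).trans hN)]
  | hmem n h =>
    intro N g g' hN hg
    rw [sat_mem h, sat_mem h, hg _ ((larg_le n).trans hN), hg _ ((rarg_le n).trans hN)]
  | himp n h ih1 ih2 =>
    intro N g g' hN hg
    rw [sat_imp h, sat_imp h, ih1 N ((larg_le n).trans hN) hg, ih2 N ((rarg_le n).trans hN) hg]
  | hall n h ih =>
    intro N g g' hN hg
    rw [sat_all h, sat_all h]
    refine forall₂_congr fun x _ => ih N ((rarg_le n).trans hN) fun k hk => ?_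
    by_cases hkl : k = larg n
    · subst hkl; simp
    · simp [hkl, hg k hk]
  | hother n h1 h2 h3 h4 =>
    intro N g g' _ _
    exact iff_of_false (sat_other h1 h2 h3 h4) (sat_other h1 h2 h3 h4)

/-- Every first-order formula in two variables has a code. -/
theorem exists_sat_iff {k : ℕ} (φ : memLang.BoundedFormula (Fin 2) k) :
    letI := memStructure (fun x y : ZFSet.{u} => x ∈ y)
    ∃ n, ∀ g : ℕ → ZFSet.{u}, Sat Set.univ n g ↔
      φ.Realize (fun i => g i) fun i : Fin k => g (2 + i) := by
  let _ := memStructure (fun x y : ZFSet.{u} => x ∈ y)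
  have hterm : ∀ {k : ℕ} (t : memLang.Term (Fin 2 ⊕ Fin k)), ∃ j : ℕ, ∀ g : ℕ → ZFSet.{u},
      t.realize (Sum.elim (fun i : Fin 2 => g i) fun i : Fin k => g (2 + i)) = g j := by
    intro k t
    rcases t with (i | i) | ⟨f, -⟩
    · exact ⟨i, fun _ => rfl⟩
    · exact ⟨2 + i, fun _ => rfl⟩
    · exact f.elim
  induction φ with
  | falsum =>
    obtain ⟨n, hn, -⟩ := exists_code 0 0 0
    exact ⟨n, fun g => iff_of_false (sat_other (by omega) (by omega) (by omega) (by omega)) id⟩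
  | equal t₁ t₂ =>
    obtain ⟨i, hi⟩ := hterm t₁
    obtain ⟨j, hj⟩ := hterm t₂
    obtain ⟨n, hn, rfl, rfl⟩ := exists_code 1 i j
    exact ⟨n, fun g => (sat_eq hn).trans (by rw [← hi g, ← hj g]; rfl)⟩
  | rel R ts =>
    cases R
    obtain ⟨i, hi⟩ := hterm (ts 0)
    obtain ⟨j, hj⟩ := hterm (ts 1)
    obtain ⟨n, hn, rfl, rfl⟩ := exists_code 2 i j
    exact ⟨n, fun g => (sat_mem hn).trans (iff_of_eq (congrArg₂ _ (hj g).symm (hi g).symm))⟩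
  | imp φ ψ ih₁ ih₂ =>
    obtain ⟨i, hi⟩ := ih₁
    obtain ⟨j, hj⟩ := ih₂
    obtain ⟨n, hn, rfl, rfl⟩ := exists_code 3 i j
    exact ⟨n, fun g => by rw [sat_imp hn, hi, hj]; rfl⟩
  | @all k φ ih =>
    obtain ⟨j, hj⟩ := ih
    -- The free variables have numbers `0` and `1`, the variable bound at depth `k` has number `2 +
    -- k`.
    obtain ⟨n, hn, hl, rfl⟩ := exists_code 4 (2 + k) j
    refine ⟨n, fun g => ?_⟩
    rw [sat_all hn, Language.BoundedFormula.realize_all]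
    refine ⟨fun h x => ?_, fun h x _ => ?_⟩
    all_goals
      have key := hj (Function.update g (larg n) x)
      have h1 : (fun i : Fin 2 => Function.update g (larg n) x i) = fun i : Fin 2 => g i := by
        ext1 i
        exact Function.update_of_ne (by omega) _ _
      have h2 : (fun i : Fin (k + 1) => Function.update g (larg n) x (2 + i)) =
          Fin.snoc (fun i : Fin k => g (2 + i)) x := by
        ext1 i
        refine Fin.lastCases ?_ (fun i => ?_) i
        · simp [hl]
        · rw [Fin.snoc_castSucc]
          exact Function.update_of_ne (by simp [hl]; omega) _ _
      rw [h1, h2] at key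
    · exact key.1 (h x trivial)
    · exact key.2 (h x)

end Sat

/-! ### Reflection -/

/-- Codes, variables and assignments into `V_a` form a small family, so the ranks of chosen
counterexamples are bounded. -/
theorem exists_vonNeumann_witnesses (a : Ordinal.{u}) : ∃ b, a ≤ b ∧
    ∀ (n i : ℕ) (g : ℕ → ZFSet.{u}), (∀ k, g k ∈ ZFSet.vonNeumann a) →
      (∃ x, ¬ Sat Set.univ n (Function.update g i x)) →
      ∃ x ∈ ZFSet.vonNeumann b, ¬ Sat Set.univ n (Function.update g i x) := by
  classical
  let I := ℕ × ℕ × (ℕ → (ZFSet.vonNeumann a : ZFSet.{u}))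
  let w : I → ZFSet.{u} := fun c =>
    if h : ∃ x, ¬ Sat Set.univ c.1 (Function.update (fun k => (c.2.2 k : ZFSet.{u})) c.2.1 x)
    then h.choose else ∅
  obtain ⟨b, hb⟩ := Ordinal.bddAbove_of_small (s := Set.range fun c : I => (w c).rank)
  refine ⟨max a (Order.succ b), le_max_left _ _, fun n i g hg hx => ?_⟩
  let c : I := (n, i, fun k => ⟨g k, hg k⟩)
  refine ⟨w c, ZFSet.mem_vonNeumann.2 (lt_max_of_lt_right (Order.lt_succ_of_le (hb ⟨c, rfl⟩))), ?_⟩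
  have : w c = hx.choose := dif_pos hx
  rw [this]
  exact hx.choose_spec

/-- The reflection principle: some stage of the von Neumann hierarchy that contains `t` is an
elementary substructure of the universe. -/
theorem exists_reflecting (t : ZFSet.{u}) : ∃ U, IsLevel U ∧ t ∈ U ∧
    ∀ (n : ℕ) (g : ℕ → ZFSet.{u}), (∀ k, g k ∈ U) → (Sat U n g ↔ Sat Set.univ n g) := by
  choose F hF hw using exists_vonNeumann_witnesses.{u}
  -- Closing off `ω` times under `F`, starting just above the rank of `t`.
  let o : ℕ → Ordinal.{u} := fun n => F^[n] (Order.succ t.rank)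
  have ho : Monotone o := monotone_nat_of_le_succ fun n => by
    simp only [o, Function.iterate_succ_apply']
    exact hF _
  have hmem : ∀ x, x ∈ ZFSet.vonNeumann (⨆ n, o n) ↔ ∃ n, x ∈ ZFSet.vonNeumann (o n) := fun x => by
    simp only [ZFSet.mem_vonNeumann, Ordinal.lt_iSup_iff]
  refine ⟨ZFSet.vonNeumann (⨆ n, o n), ⟨_, rfl⟩, (hmem t).2 ⟨0, ZFSet.mem_vonNeumann_succ t⟩, ?_⟩
  intro n
  induction n using code_induction with
  | heq n h => intro g _; rw [sat_eq h, sat_eq h]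
  | hmem n h => intro g _; rw [sat_mem h, sat_mem h]
  | himp n h ih1 ih2 => intro g hg; rw [sat_imp h, sat_imp h, ih1 g hg, ih2 g hg]
  | hother n h1 h2 h3 h4 =>
    intro g _
    exact iff_of_false (sat_other h1 h2 h3 h4) (sat_other h1 h2 h3 h4)
  | hall n h ih =>
    intro g hg
    have hup : ∀ x ∈ ZFSet.vonNeumann (⨆ n, o n), ∀ k,
        Function.update g (larg n) x k ∈ ZFSet.vonNeumann (⨆ n, o n) := by
      intro x hx k
      by_cases hk : k = larg n
      · subst hk; simpa using hx
      · simpa [hk] using hg k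
    rw [sat_all h, sat_all h]
    refine ⟨fun H x _ => ?_, fun H x hx => (ih _ (hup x hx)).2 (H x trivial)⟩
    by_contra hx
    choose m hm using fun k => (hmem _).1 (hg k)
    -- The infinitely many values of `g` need not lie in one stage `o N`. Those with index at most
    -- `n` do, and the others are irrelevant to the formula, so they are replaced by `g 0`.
    let g' : ℕ → ZFSet.{u} := fun k => if k ≤ n then g k else g 0
    let N := (Finset.range (n + 1)).sup m
    have hg' : ∀ k, g' k ∈ ZFSet.vonNeumann (o N) := by
      intro k
      have key : ∀ k ≤ n, g k ∈ ZFSet.vonNeumann (o N) := fun k hk =>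
        ZFSet.vonNeumann_subset_of_le
          (ho (Finset.le_sup (f := m) (by simpa [Nat.lt_succ_iff] using hk))) (hm k)
      by_cases hk : k ≤ n
      · simpa [g', hk] using key k hk
      · simpa [g', hk] using key 0 (Nat.zero_le _)
    have hcongr : ∀ x, Sat Set.univ (rarg n) (Function.update g (larg n) x) ↔
        Sat Set.univ (rarg n) (Function.update g' (larg n) x) := fun x =>
      sat_congr _ n (rarg_le n) fun k hk => by
        by_cases hkl : k = larg n
        · subst hkl; simp
        · simp [hkl, g', hk]
    obtain ⟨y, hy, hsat⟩ := hw (o N) (rarg n) (larg n) g' hg' ⟨x, fun h => hx ((hcongr x).2 h)⟩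
    have hyU : y ∈ ZFSet.vonNeumann (⨆ n, o n) := (hmem y).2 ⟨N + 1, by
      simpa only [o, Function.iterate_succ_apply'] using hy⟩
    exact hsat ((hcongr y).1 ((ih _ (hup y hyU)).1 (H y hyU)))

/-! ### Definability of satisfaction -/

/-- `n` codes the formula with principal symbol `o` and arguments `i`, `j`. -/
def IsCode (n o i j : ZFSet.{u}) : Prop := ∃ l, IsWalk n o l ∧ IsWalk l i j

/-- `R` is a satisfaction relation for the structure `(U, ∈)`. -/
def IsTable (R U : ZFSet.{u}) : Prop :=
  ∀ n o i j σ, IsCode n o i j → ZFSet.IsFunc ZFSet.omega U σ →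
    (o = nat 1 → (ZFSet.pair n σ ∈ R ↔ app σ i = app σ j)) ∧
    (o = nat 2 → (ZFSet.pair n σ ∈ R ↔ app σ i ∈ app σ j)) ∧
    (o = nat 3 → (ZFSet.pair n σ ∈ R ↔ (ZFSet.pair i σ ∈ R → ZFSet.pair j σ ∈ R))) ∧
    (o = nat 4 → (ZFSet.pair n σ ∈ R ↔ ∀ τ, ZFSet.IsFunc ZFSet.omega U τ →
      (∀ k, k ∈ ZFSet.omega → ¬ k = i → app τ k = app σ k) → ZFSet.pair j τ ∈ R)) ∧
    (¬ o = nat 1 → ¬ o = nat 2 → ¬ o = nat 3 → ¬ o = nat 4 → ¬ ZFSet.pair n σ ∈ R)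

/-- `x` is the only element of `U` that satisfies in `(U, ∈)` the formula coded by `n` with
parameter `t`. -/
def IsDefinedIn (x U n t : ZFSet.{u}) : Prop :=
  x ∈ U ∧ n ∈ ZFSet.omega ∧ ∀ y, y ∈ U → ((∃ R σ, IsTable R U ∧ ZFSet.IsFunc ZFSet.omega U σ ∧
    app σ (nat 0) = y ∧ app σ (nat 1) = t ∧ ZFSet.pair n σ ∈ R) ↔ y = x)

/-- `x` is the element of `Z` that is definable from `t` in the first possible stage of the von
Neumann hierarchy, by the first possible formula. -/
def IsChosen (x Z t : ZFSet.{u}) : Prop :=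
  x ∈ Z ∧ ∃ U n, IsLevel U ∧ IsDefinedIn x U n t ∧
    ∀ y U' n', y ∈ Z → IsLevel U' → IsDefinedIn y U' n' t →
      U ∈ U' ∨ U = U' ∧ (n ∈ n' ∨ n = n')

section Definability

variable {ι : Type} {f g h k : (ι → ZFSet.{u}) → ZFSet.{u}}

instance dfun_nat (n : ℕ) : DFun fun _ : ι → ZFSet.{u} => nat n := by
  induction n with
  | zero => rw [nat_zero]; infer_instance
  | succ n ih => rw [nat_succ]; infer_instance

instance dfn_isCode [hf : DFun f] [hg : DFun g] [hh : DFun h] [hk : DFun k] :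
    Dfn fun v => IsCode (f v) (g v) (h v) (k v) :=
  .subst₄ (Q := IsCode) (inferInstance : Dfn fun v : Fin 4 → ZFSet.{u} =>
    ∃ l, IsWalk (v 0) (v 1) l ∧ IsWalk l (v 2) (v 3)) hf hg hh hk

set_option synthInstance.maxSize 2000 in
set_option synthInstance.maxHeartbeats 400000 in
instance dfn_isTable [hf : DFun f] [hg : DFun g] : Dfn fun v => IsTable (f v) (g v) :=
  .subst₂ (Q := IsTable) (by unfold IsTable; infer_instance) hf hg

instance dfn_isDefinedIn [hf : DFun f] [hg : DFun g] [hh : DFun h] [hk : DFun k] :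
    Dfn fun v => IsDefinedIn (f v) (g v) (h v) (k v) :=
  .subst₄ (Q := IsDefinedIn) (by unfold IsDefinedIn; infer_instance) hf hg hh hk

instance dfn_isChosen [hf : DFun f] [hg : DFun g] [hh : DFun h] :
    Dfn fun v => IsChosen (f v) (g v) (h v) :=
  .subst₃ (Q := IsChosen) (by unfold IsChosen; infer_instance) hf hg hh

end Definability

/-! ### Agreement of the internal satisfaction relation with `Sat` -/

theorem isCode_iff {n o i j : ZFSet.{u}} : IsCode n o i j ↔
    ∃ m, n = nat m ∧ o = nat (op m) ∧ i = nat (larg m) ∧ j = nat (rarg m) := by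
  constructor
  · rintro ⟨l, ⟨m, rfl, rfl, rfl⟩, m', hm', rfl, rfl⟩
    obtain rfl := nat_inj.1 hm'
    exact ⟨m, rfl, rfl, rfl, rfl⟩
  · rintro ⟨m, rfl, rfl, rfl, rfl⟩
    exact ⟨_, ⟨m, rfl, rfl, rfl⟩, _, rfl, rfl, rfl⟩

theorem isTable_iff {R U : ZFSet.{u}} : IsTable R U ↔
    ∀ (m : ℕ) (g : ℕ → ZFSet.{u}), (∀ k, g k ∈ U) →
    (op m = 1 → (ZFSet.pair (nat m) (seq g) ∈ R ↔ g (larg m) = g (rarg m))) ∧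
    (op m = 2 → (ZFSet.pair (nat m) (seq g) ∈ R ↔ g (larg m) ∈ g (rarg m))) ∧
    (op m = 3 → (ZFSet.pair (nat m) (seq g) ∈ R ↔
      (ZFSet.pair (nat (larg m)) (seq g) ∈ R → ZFSet.pair (nat (rarg m)) (seq g) ∈ R))) ∧
    (op m = 4 → (ZFSet.pair (nat m) (seq g) ∈ R ↔ ∀ x ∈ U,
      ZFSet.pair (nat (rarg m)) (seq (Function.update g (larg m) x)) ∈ R)) ∧
    (¬ op m = 1 → ¬ op m = 2 → ¬ op m = 3 → ¬ op m = 4 → ¬ ZFSet.pair (nat m) (seq g) ∈ R) := by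
  -- The sequences agreeing with `seq g` off the quantified variable are exactly the updates of `g`
  -- there, so the quantifier clause takes the form it has in `Sat`.
  have hall : ∀ (m : ℕ) (g : ℕ → ZFSet.{u}), (∀ k, g k ∈ U) →
      ((∀ τ, ZFSet.IsFunc ZFSet.omega U τ → (∀ k, k ∈ ZFSet.omega → ¬ k = nat (larg m) →
        app τ k = app (seq g) k) → ZFSet.pair (nat (rarg m)) τ ∈ R) ↔ ∀ x ∈ U,
        ZFSet.pair (nat (rarg m)) (seq (Function.update g (larg m) x)) ∈ R) := by
    intro m g hg
    constructor
    · intro H x hx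
      refine H _ (isFunc_omega_iff.2 ⟨_, fun k => ?_, rfl⟩) fun k hk hkl => ?_
      · by_cases hk : k = larg m
        · subst hk; simpa using hx
        · simpa [hk] using hg k
      · obtain ⟨k, rfl⟩ := mem_omega_iff.1 hk
        rw [nat_inj] at hkl
        simp [hkl]
    · intro H τ hτ hagree
      obtain ⟨g', hg', rfl⟩ := isFunc_omega_iff.1 hτ
      convert H (g' (larg m)) (hg' _) using 2
      refine congrArg seq (funext fun k => ?_)
      by_cases hk : k = larg m
      · subst hk; simp
      · simpa [hk] using hagree (nat k) (nat_mem_omega k) (by simpa using hk)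
  constructor
  · intro H m g hg
    have := H _ _ _ _ (seq g) (isCode_iff.2 ⟨m, rfl, rfl, rfl, rfl⟩)
      (isFunc_omega_iff.2 ⟨g, hg, rfl⟩)
    simpa only [nat_inj, app_seq, hall m g hg] using this
  · intro H n o i j σ hc hσ
    obtain ⟨m, rfl, rfl, rfl, rfl⟩ := isCode_iff.1 hc
    obtain ⟨g, hg, rfl⟩ := isFunc_omega_iff.1 hσ
    simpa only [nat_inj, app_seq, hall m g hg] using H m g hg

theorem IsTable.pair_mem_iff {R U : ZFSet.{u}} (hR : IsTable R U) (n : ℕ) :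
    ∀ {g : ℕ → ZFSet.{u}}, (∀ k, g k ∈ U) →
      (ZFSet.pair (nat n) (seq g) ∈ R ↔ Sat U n g) := by
  rw [isTable_iff] at hR
  induction n using code_induction with
  | heq n h => intro g hg; rw [sat_eq h, (hR n g hg).1 h]
  | hmem n h => intro g hg; rw [sat_mem h, (hR n g hg).2.1 h]
  | himp n h ih1 ih2 => intro g hg; rw [sat_imp h, (hR n g hg).2.2.1 h, ih1 hg, ih2 hg]
  | hall n h ih =>
    intro g hg
    rw [sat_all h, (hR n g hg).2.2.2.1 h]
    refine forall₂_congr fun x hx => ih fun k => ?_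
    by_cases hk : k = larg n
    · subst hk; simpa using hx
    · simpa [hk] using hg k
  | hother n h1 h2 h3 h4 =>
    intro g hg
    exact iff_of_false ((hR n g hg).2.2.2.2 h1 h2 h3 h4) (sat_other h1 h2 h3 h4)

theorem exists_isTable (U : ZFSet.{u}) : ∃ R, IsTable R U := by
  let R := (ZFSet.prod ZFSet.omega (ZFSet.funs ZFSet.omega U)).sep fun p =>
    ∃ n g, p = ZFSet.pair (nat n) (seq g) ∧ Sat U n g
  have hR : ∀ n g, (∀ k, g k ∈ U) → (ZFSet.pair (nat n) (seq g) ∈ R ↔ Sat U n g) := by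
    intro n g hg
    rw [ZFSet.mem_sep, ZFSet.pair_mem_prod, ZFSet.mem_funs, isFunc_omega_iff]
    constructor
    · rintro ⟨-, m, g', h, hs⟩
      rw [ZFSet.pair_inj, nat_inj, seq_injective.eq_iff] at h
      rwa [h.1, h.2]
    · intro h
      exact ⟨⟨nat_mem_omega n, g, hg, rfl⟩, n, g, rfl, h⟩
  refine ⟨R, isTable_iff.2 fun m g hg => ?_⟩
  rw [hR m g hg, hR _ g hg, hR _ g hg]
  refine ⟨sat_eq, sat_mem, sat_imp, fun h => (sat_all h).trans ?_, sat_other⟩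
  refine forall₂_congr fun x hx => (hR _ _ fun k => ?_).symm
  by_cases hk : k = larg m
  · subst hk; simpa using hx
  · simpa [hk] using hg k

theorem isDefinedIn_iff {x U t : ZFSet.{u}} {n : ℕ} : IsDefinedIn x U (nat n) t ↔
    x ∈ U ∧ ∀ y ∈ U, (∃ g : ℕ → ZFSet.{u}, (∀ k, g k ∈ U) ∧ g 0 = y ∧ g 1 = t ∧ Sat U n g) ↔
      y = x := by
  rw [IsDefinedIn, and_iff_right (nat_mem_omega n)]
  refine and_congr_right fun _ => forall₂_congr fun y _ => iff_congr ?_ Iff.rfl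
  constructor
  · rintro ⟨R, σ, hR, hσ, h0, h1, h⟩
    obtain ⟨g, hg, rfl⟩ := isFunc_omega_iff.1 hσ
    exact ⟨g, hg, by simpa using h0, by simpa using h1, (hR.pair_mem_iff n hg).1 h⟩
  · rintro ⟨g, hg, h0, h1, h⟩
    obtain ⟨R, hR⟩ := exists_isTable U
    exact ⟨R, seq g, hR, isFunc_omega_iff.2 ⟨g, hg, rfl⟩, by simpa using h0, by simpa using h1,
      (hR.pair_mem_iff n hg).2 h⟩

theorem IsDefinedIn.unique {x x' U n t : ZFSet.{u}} (h : IsDefinedIn x U n t)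
    (h' : IsDefinedIn x' U n t) : x = x' :=
  (h'.2.2 x h.1).1 ((h.2.2 x h.1).2 rfl)

/-- Minimality on both sides forces the pairs `(U, n)` and `(U', n')` to coincide, and one pair
defines at most one element. -/
theorem IsChosen.unique {x x' Z t : ZFSet.{u}} (h : IsChosen x Z t) (h' : IsChosen x' Z t) :
    x = x' := by
  obtain ⟨hx, U, n, hU, hd, hmin⟩ := h
  obtain ⟨hx', U', n', hU', hd', hmin'⟩ := h'
  have h1 := hmin _ _ _ hx' hU' hd'
  have h2 := hmin' _ _ _ hx hU hd
  rcases h1 with h1 | ⟨rfl, h1⟩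
  · rcases h2 with h2 | ⟨rfl, -⟩
    · exact absurd h2 (ZFSet.mem_asymm h1)
    · exact absurd h1 (ZFSet.mem_irrefl _)
  · replace h2 : n' ∈ n ∨ n' = n := h2.elim (fun h => absurd h (ZFSet.mem_irrefl _)) And.right
    rcases h1 with h1 | rfl
    · rcases h2 with h2 | rfl
      · exact absurd h2 (ZFSet.mem_asymm h1)
      · exact absurd h1 (ZFSet.mem_irrefl _)
    · exact hd.unique hd'

/-- Take the least pair in the lexicographic well-order of `Ordinal ×ₗ ℕ`. -/
theorem exists_isChosen {x Z U n t : ZFSet.{u}} (hx : x ∈ Z) (hU : IsLevel U)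
    (hd : IsDefinedIn x U n t) : ∃ y, IsChosen y Z t := by
  obtain ⟨o, rfl⟩ := hU
  obtain ⟨m, rfl⟩ := mem_omega_iff.1 hd.2.1
  let S : Set (Ordinal.{u} ×ₗ ℕ) := {c | ∃ y ∈ Z,
    IsDefinedIn y (ZFSet.vonNeumann (ofLex c).1) (nat (ofLex c).2) t}
  obtain ⟨c, ⟨y, hy, hyd⟩, hmin⟩ := (wellFounded_lt (α := Ordinal.{u} ×ₗ ℕ)).has_min S
    ⟨toLex (o, m), x, hx, hd⟩
  refine ⟨y, hy, _, _, ⟨_, rfl⟩, hyd, ?_⟩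
  rintro y' _ n' hy' ⟨o', rfl⟩ hd'
  obtain ⟨m', rfl⟩ := mem_omega_iff.1 hd'.2.1
  have := not_lt.1 (hmin (toLex (o', m')) ⟨y', hy', hd'⟩)
  rw [Prod.Lex.le_iff] at this
  simpa [ZFSet.vonNeumann_inj, le_iff_lt_or_eq] using this

/-! ### Uniform definitions of the sets definable from ordinals and a sequence -/

/-- In an elementary stage containing `t`, the formula that defines `x` from `t` in the universe
still defines `x`. -/
theorem exists_isDefinedIn_of_mem_dcl_singleton {x t : ZFSet.{u}} (hx : x ∈ dcl {t}) :
    ∃ U n, IsLevel U ∧ IsDefinedIn x U n t := by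
  let _ := memStructure (fun x y : ZFSet.{u} => x ∈ y)
  obtain ⟨ι, _, R, p, ⟨φ, hφ⟩, hp, hx⟩ := hx
  obtain rfl : p = fun _ => t := funext hp
  obtain ⟨n, hn⟩ := exists_sat_iff.{u} (φ.relabel fun o => o.elim (0 : Fin 2) fun _ => 1)
  have hsat : ∀ g : ℕ → ZFSet.{u}, g 1 = t → (Sat Set.univ n g ↔ g 0 = x) := by
    rintro g rfl
    have hg : ((fun i : Fin 2 => g i) ∘ fun o : Option ι => o.elim (0 : Fin 2) fun _ => 1) =
        fun o => o.elim (g 0) fun _ => g 1 := funext (by rintro (_ | _) <;> rfl)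
    have key := Language.Formula.realize_relabel (φ := φ) (v := fun i : Fin 2 => g i)
      (g := fun o : Option ι => o.elim (0 : Fin 2) fun _ => 1)
    rw [hg, hφ] at key
    rw [hn, ← hx]
    refine Iff.trans ?_ key
    exact iff_of_eq (congrArg _ (Subsingleton.elim _ _))
  obtain ⟨U, hU, htU, hrefl⟩ := exists_reflecting t
  -- Here `b` codes falsity, `i` the negation of formula `n`, and `c` its universal closure over
  -- variable `0`. If `x ∉ U`, then `c` would hold in `U`, hence in the universe, where `x` refutes
  -- it.
  have hxU : x ∈ U := by
    obtain ⟨b, hb, -⟩ := exists_code 0 0 0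
    obtain ⟨i, hi, hil, hir⟩ := exists_code 3 n b
    obtain ⟨c, hc, hcl, hcr⟩ := exists_code 4 0 i
    have hbot : ∀ (U : Set ZFSet.{u}) g, ¬ Sat U b g := fun U g =>
      sat_other (by omega) (by omega) (by omega) (by omega)
    have key := hrefl c (fun _ => t) fun _ => htU
    rw [sat_all hc, sat_all hc, hcl, hcr] at key
    by_contra hxU
    refine hbot Set.univ (Function.update (fun _ => t) 0 x) (hir ▸ (sat_imp hi).1
      (key.1 (fun y hy => ?_) x trivial) ?_)
    · rw [sat_imp hi, hil]
      intro h
      have hg : ∀ k, Function.update (fun _ => t) 0 y k ∈ U := by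
        intro k
        by_cases hk : k = 0
        · subst hk; simpa using hy
        · simpa [hk] using htU
      rw [SetLike.mem_coe] at hy
      have := (hsat _ (by simp)).1 ((hrefl n _ hg).1 h)
      simp only [Function.update_self] at this
      exact absurd (this ▸ hy) hxU
    · rw [hil]
      exact (hsat _ (by simp)).2 (by simp)
  refine ⟨U, nat n, hU, isDefinedIn_iff.2 ⟨hxU, fun y hy => ?_⟩⟩
  constructor
  · rintro ⟨g, hg, rfl, h1, h⟩
    exact (hsat g h1).1 ((hrefl n g hg).1 h)
  · rintro rfl
    have hg : ∀ k, Function.update (fun _ => t) 0 y k ∈ U := by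
      intro k
      by_cases hk : k = 0
      · subst hk; simpa using hy
      · simpa [hk] using htU
    exact ⟨_, hg, by simp, by simp, (hrefl n _ hg).2 ((hsat _ (by simp)).2 (by simp))⟩

/-- Suppose no stage defines `x` from `t`. Then some ordinals make the formula define, together with
`t`, a set with this defect (`Q`). By `exists_ordinals_mem_dcl` such ordinals exist in `dcl {t}`;
the set `x'` they define need not be `x`, but it lies in `dcl {t}`, against the case without
ordinals. -/
theorem exists_isDefinedIn_of_mem_dcl {x t : ZFSet.{u}} (hx : x ∈ dcl ({x | x.IsOrdinal} ∪ {t})) :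
    ∃ U n, IsLevel U ∧ IsDefinedIn x U n t := by
  classical
  obtain ⟨ι, _, R, p, hR, hp, hx⟩ := hx
  by_contra hno
  let e := Finite.equivFin ι
  -- Ordinal parameters become variables to be minimised; every other parameter equals `t`.
  let c : ι → Unit ⊕ Fin (Nat.card ι) := fun i => if (p i).IsOrdinal then .inr (e i) else .inl ()
  let Q : (Unit → ZFSet.{u}) → (Fin (Nat.card ι) → ZFSet.{u}) → Prop := fun q α =>
    ∃ x, (∀ y, R (fun i => Sum.elim q α (c i)) y ↔ y = x) ∧
      ¬ ∃ U n, IsLevel U ∧ IsDefinedIn x U n (q ())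
  have hQ : Dfn fun w : Unit ⊕ Fin (Nat.card ι) → ZFSet.{u} =>
      Q (fun i => w (.inl i)) fun k => w (.inr k) := by
    have h1 := hR.comp (κ := Option (Option (Unit ⊕ Fin (Nat.card ι)))) fun o =>
      o.elim none fun i => some (some (c i))
    have h2 := Dfn.all (h := Dfn.iff (hP := h1) (hQ := (inferInstance :
      Dfn fun w : Option (Option (Unit ⊕ Fin (Nat.card ι))) → ZFSet.{u} =>
        w none = w (some none)))) (R := fun v y => R (fun i => v (some (c i))) y ↔ y = v none)
    have h3 : Dfn fun v : Option (Unit ⊕ Fin (Nat.card ι)) → ZFSet.{u} =>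
      ¬ ∃ U n, IsLevel U ∧ IsDefinedIn (v none) U n (v (some (.inl ()))) := inferInstance
    refine (Dfn.ex (h := Dfn.and (hP := h2) (hQ := h3)) (R := fun v x =>
      (∀ y, R (fun i => v (c i)) y ↔ y = x) ∧
      ¬ ∃ U n, IsLevel U ∧ IsDefinedIn x U n (v (.inl ())))).congr fun v => ?_
    have : ∀ i, Sum.elim (fun i => v (.inl i)) (fun k => v (.inr k)) (c i) = v (c i) := by
      intro i
      rcases c i with j | j <;> rfl
    simp only [Q, this]
  -- Slots of non-ordinal parameters are never read; `∅` only keeps them ordinals.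
  let α₀ : Fin (Nat.card ι) → ZFSet.{u} := fun k =>
    if (p (e.symm k)).IsOrdinal then p (e.symm k) else ∅
  have hα₀ : ∀ k, (α₀ k).IsOrdinal := by
    intro k
    dsimp only [α₀]
    split_ifs with h
    · exact h
    · exact ZFSet.isOrdinal_empty
  have hQα₀ : Q (fun _ => t) α₀ := by
    refine ⟨x, fun y => ?_, hno⟩
    rw [← hx]
    refine iff_of_eq (congrArg (R · y) (funext fun i => ?_))
    by_cases h : (p i).IsOrdinal
    · simp [c, α₀, h]
    · simpa [c, h] using ((hp i).resolve_left h).symm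
  obtain ⟨α, hα, x', hx', hno'⟩ := exists_ordinals_mem_dcl (B := {t}) _ Q hQ (fun _ => t)
    (fun _ => subset_dcl rfl) ⟨α₀, hα₀, hQα₀⟩
  refine hno' (exists_isDefinedIn_of_mem_dcl_singleton (mem_dcl_of_dfn hR (fun i => ?_)
    ((hx' x').2 rfl) fun y => (hx' y).1))
  rcases c i with j | j
  · exact subset_dcl rfl
  · exact hα j

/-- The finitely many sequences among the parameters are rows of one sequence `join F`, each
recovered from its row number, which is an ordinal. Rows without a sequence are filled with `m₀`. -/
theorem exists_isDefinedIn_of_mem_OD {M : Set ZFSet.{u}} (hM : M.Nonempty) {x : ZFSet.{u}}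
    (hx : x ∈ OD (omegaSeq M)) : ∃ t ∈ omegaSeq M, ∃ U n, IsLevel U ∧ IsDefinedIn x U n t := by
  classical
  rw [OD_eq_dcl] at hx
  obtain ⟨m₀, hm₀⟩ := hM
  obtain ⟨ι, _, R, p, hR, hp, hx⟩ := hx
  let e := Finite.equivFin ι
  have hG : ∀ i, ∃ g : ℕ → ZFSet.{u}, (∀ k, g k ∈ M) ∧ ((p i).IsOrdinal ∨ p i = seq g) := by
    intro i
    rcases hp i with h | h
    · exact ⟨fun _ => m₀, fun _ => hm₀, .inl h⟩
    · obtain ⟨g, hg, h⟩ := mem_omegaSeq.1 h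
      exact ⟨g, hg, .inr h⟩
  choose G hGM hGp using hG
  let F : ℕ → ℕ → ZFSet.{u} := fun m =>
    if h : m < Nat.card ι then G (e.symm ⟨m, h⟩) else fun _ => m₀
  have hFM : ∀ m k, F m k ∈ M := by
    intro m k
    by_cases h : m < Nat.card ι
    · simpa [F, h] using hGM _ k
    · simpa [F, h] using hm₀
  refine ⟨join F, join_mem_omegaSeq hFM, exists_isDefinedIn_of_mem_dcl (mem_dcl_of_dfn hR
    (fun i => ?_) ((hx x).2 rfl) fun y => (hx y).1)⟩
  rcases hGp i with h | h
  · exact subset_dcl (.inl h)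
  · have hF : F (e i) = G i := by simp [F]
    rw [h, ← hF, ← row_join]
    exact DFun.mem_dcl (F := fun v : Fin 2 → ZFSet.{u} => row (v 0) (v 1)) inferInstance
      (p := ![join F, nat (e i)])
      (by
        simp only [Fin.forall_fin_two]
        exact ⟨subset_dcl (.inr rfl), subset_dcl (.inl (isOrdinal_nat _))⟩)

/-! ### Hereditarily definable sets -/

theorem mem_HOD_iff {X : Set ZFSet.{u}} {a : ZFSet.{u}} :
    a ∈ HOD X ↔ a ∈ OD X ∧ ∀ y ∈ a, y ∈ HOD X := by
  have hself : ∀ a : ZFSet.{u}, a ∈ tcl {a} := fun a t _ ha => ha (by simp)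
  constructor
  · intro h
    refine ⟨h (hself a), fun y hy b hb => h fun t ht ha => hb t ht ?_⟩
    intro z hz
    obtain rfl := ZFSet.mem_singleton.1 hz
    exact ht.mem_trans hy (ha (by simp))
  · rintro ⟨ha, hmem⟩ b hb
    by_contra hbX
    -- If `b` is not in `OD X`, each `y ∈ a` lies in a transitive set omitting `b`. The union of
    -- these sets, with `a` added, is transitive, so it contains `b`; this leaves only `b = a`,
    -- which is in `OD X`.
    have h : ∀ y : a, ∃ t : ZFSet.{u}, t.IsTransitive ∧ (y : ZFSet.{u}) ∈ t ∧
        b ∉ t := by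
      rintro ⟨y, hy⟩
      by_contra! hno
      exact hbX (hmem y hy fun t ht hyt => hno t ht (hyt (by simp)))
    choose t ht hyt hbt using h
    have := hb (insert a (ZFSet.iUnion t)) ?_ (by simp [ZFSet.subset_def])
    · rcases ZFSet.mem_insert_iff.1 this with rfl | h
      · exact hbX ha
      · obtain ⟨y, hy⟩ := ZFSet.mem_iUnion.1 h
        exact hbt y hy
    · intro z hz w hw
      refine ZFSet.mem_insert_of_mem _ (ZFSet.mem_iUnion.2 ?_)
      rcases ZFSet.mem_insert_iff.1 hz with rfl | hz
      · exact ⟨⟨w, hw⟩, hyt ⟨w, hw⟩⟩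
      · obtain ⟨y, hy⟩ := ZFSet.mem_iUnion.1 hz
        exact ⟨y, (ht y).mem_trans hw hy⟩

section HOD

variable {X : Set ZFSet.{u}}

theorem mem_HOD_of_mem {a y : ZFSet.{u}} (ha : a ∈ HOD X) (hy : y ∈ a) : y ∈ HOD X :=
  (mem_HOD_iff.1 ha).2 y hy

theorem mem_OD_of_mem_HOD {a : ZFSet.{u}} (ha : a ∈ HOD X) : a ∈ OD X := (mem_HOD_iff.1 ha).1

theorem unorderedPair_mem_HOD {x y : ZFSet.{u}} (hx : x ∈ HOD X) (hy : y ∈ HOD X) :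
    {x, y} ∈ HOD X := by
  refine mem_HOD_iff.2 ⟨?_, fun z hz => ?_⟩
  · have hx' := mem_OD_of_mem_HOD hx
    have hy' := mem_OD_of_mem_HOD hy
    rw [OD_eq_dcl] at *
    exact DFun.mem_dcl (F := fun v : Fin 2 → ZFSet.{u} => {v 0, v 1}) inferInstance (p := ![x, y])
      (by simp [Fin.forall_fin_two, hx', hy'])
  · rcases ZFSet.mem_pair.1 hz with rfl | rfl <;> assumption

theorem pair_mem_HOD {x y : ZFSet.{u}} (hx : x ∈ HOD X) (hy : y ∈ HOD X) :
    ZFSet.pair x y ∈ HOD X := by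
  have := unorderedPair_mem_HOD hx hx
  rw [ZFSet.pair_eq_singleton] at this
  exact unorderedPair_mem_HOD this (unorderedPair_mem_HOD hx hy)

theorem nat_mem_HOD (n : ℕ) : nat n ∈ HOD X := by
  induction n using Nat.strong_induction_on with
  | _ n ih =>
    refine mem_HOD_iff.2 ⟨?_, fun y hy => ?_⟩
    · rw [OD_eq_dcl]
      exact subset_dcl (.inl (isOrdinal_nat n))
    · obtain ⟨m, rfl⟩ := exists_nat_of_mem_nat hy
      exact ih m (nat_mem_nat.1 hy)

theorem omega_mem_HOD : ZFSet.omega ∈ HOD X := by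
  refine mem_HOD_iff.2 ⟨?_, fun y hy => ?_⟩
  · rw [OD_eq_dcl]
    exact DFun.mem_dcl (ι := Fin 0) (F := fun _ => ZFSet.omega) inferInstance
      (p := fun k => k.elim0) fun k => k.elim0
  · obtain ⟨n, rfl⟩ := mem_omega_iff.1 hy
    exact nat_mem_HOD n

end HOD

/-! ### Absoluteness for transitive classes -/

/-! ### Absoluteness for transitive classes -/

section Transitive

variable {H : Set ZFSet.{u}}

/-- Equality can be tested on members in `H`; the absoluteness of `∅`, successors and pairs rests on
this. -/
theorem ext_of_transitive (hH : ∀ x ∈ H, ∀ y ∈ x, y ∈ H) {a b : ZFSet.{u}} (ha : a ∈ H)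
    (hb : ∀ z ∈ b, z ∈ H) (h : ∀ z : H, (z : ZFSet.{u}) ∈ a ↔ (z : ZFSet.{u}) ∈ b) : a = b := by
  ext z
  exact ⟨fun hz => (h ⟨z, hH _ ha _ hz⟩).1 hz, fun hz => (h ⟨z, hb _ hz⟩).2 hz⟩

theorem isEmptySet_memOn (hH : ∀ x ∈ H, ∀ y ∈ x, y ∈ H) {e : H} :
    IsEmptySet (memOn H) e ↔ (e : ZFSet.{u}) = ∅ := by
  constructor
  · intro h
    exact ext_of_transitive hH e.2 (by simp) fun z => iff_of_false (h z) (by simp)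
  · intro h z hz
    simp [memOn, h] at hz

theorem isSucc_memOn (hH : ∀ x ∈ H, ∀ y ∈ x, y ∈ H) {t s : H} :
    IsSucc (memOn H) t s ↔ (t : ZFSet.{u}) = insert (s : ZFSet.{u}) (s : ZFSet.{u}) := by
  constructor
  · intro h
    refine ext_of_transitive hH t.2 (fun z hz => ?_) fun z => (h z).trans ?_
    · rcases ZFSet.mem_insert_iff.1 hz with rfl | hz
      · exact s.2
      · exact hH _ s.2 _ hz
    · rw [ZFSet.mem_insert_iff, or_comm, Subtype.ext_iff]
      rfl
  · intro h z
    rw [memOn, h, ZFSet.mem_insert_iff, or_comm, Subtype.ext_iff]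
    rfl

theorem isPair_memOn (hH : ∀ x ∈ H, ∀ y ∈ x, y ∈ H) {p x y : H} :
    IsPair (memOn H) p x y ↔ (p : ZFSet.{u}) = ZFSet.pair x y := by
  constructor
  · rintro ⟨s, d, hs, hd, hp⟩
    have hs' : (s : ZFSet.{u}) = {(x : ZFSet.{u})} :=
      ext_of_transitive hH s.2 (by simp) fun z => (hs z).trans (by simp [Subtype.ext_iff])
    have hd' : (d : ZFSet.{u}) = {(x : ZFSet.{u}), (y : ZFSet.{u})} :=
      ext_of_transitive hH d.2 (by simp) fun z => (hd z).trans (by simp [Subtype.ext_iff])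
    refine ext_of_transitive hH p.2 (fun z hz => ?_) fun z => (hp z).trans ?_
    · rw [ZFSet.pair, ← hs', ← hd', ZFSet.mem_pair] at hz
      rcases hz with rfl | rfl
      exacts [s.2, d.2]
    · simp [Subtype.ext_iff, hs', hd', ZFSet.pair]
  · intro h
    -- Both `{x}` and `{x, y}` are members of `p`, so transitivity alone puts them in `H`.
    have hs : ({(x : ZFSet.{u})} : ZFSet.{u}) ∈ H := hH p p.2 _ (by simp [h, ZFSet.pair])
    have hd : ({(x : ZFSet.{u}), (y : ZFSet.{u})} : ZFSet.{u}) ∈ H :=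
      hH p p.2 _ (by simp [h, ZFSet.pair])
    refine ⟨⟨_, hs⟩, ⟨_, hd⟩, ?_, ?_, ?_⟩ <;>
      simp [memOn, h, ZFSet.pair, Subtype.ext_iff]

theorem pairMem_memOn (hH : ∀ x ∈ H, ∀ y ∈ x, y ∈ H) {x y r : H} :
    PairMem (memOn H) x y r ↔ ZFSet.pair (x : ZFSet.{u}) y ∈ (r : ZFSet.{u}) := by
  constructor
  · rintro ⟨p, hp, h⟩
    rw [isPair_memOn hH] at h
    exact h ▸ hp
  · intro h
    exact ⟨⟨_, hH _ r.2 _ h⟩, h, (isPair_memOn hH).2 rfl⟩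

theorem isOmega_memOn (hH : ∀ x ∈ H, ∀ y ∈ x, y ∈ H) (hω : ZFSet.omega ∈ H) :
    IsOmega (memOn H) ⟨ZFSet.omega, hω⟩ := by
  have hnat : ∀ n, nat n ∈ H := fun n => hH _ hω _ (nat_mem_omega n)
  refine ⟨⟨⟨⟨nat 0, hnat 0⟩, nat_mem_omega 0, (isEmptySet_memOn hH).2 nat_zero⟩, ?_⟩, ?_⟩
  · rintro ⟨s, hs⟩ hsω
    obtain ⟨n, rfl⟩ := mem_omega_iff.1 hsω
    exact ⟨⟨nat (n + 1), hnat _⟩, nat_mem_omega _, (isSucc_memOn hH).2 (nat_succ n)⟩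
  · rintro a ⟨⟨e, hea, he⟩, hsucc⟩ ⟨x, hx⟩ hxω
    obtain ⟨n, rfl⟩ := mem_omega_iff.1 hxω
    change nat n ∈ (a : ZFSet.{u})
    clear hx hxω
    induction n with
    | zero =>
      rw [isEmptySet_memOn hH] at he
      rw [nat_zero, ← he]
      exact hea
    | succ n ih =>
      obtain ⟨t, hta, ht⟩ := hsucc ⟨nat n, hnat n⟩ ih
      rw [isSucc_memOn hH] at ht
      rw [nat_succ, ← ht]
      exact hta

theorem isFunction_memOn (hH : ∀ x ∈ H, ∀ y ∈ x, y ∈ H) (hω : ZFSet.omega ∈ H) {a : H}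
    {g : ℕ → ZFSet.{u}} (hg : ∀ n, g n ∈ (a : ZFSet.{u})) (hf : seq g ∈ H) :
    IsFunction (memOn H) ⟨seq g, hf⟩ ⟨ZFSet.omega, hω⟩ a := by
  have hgH : ∀ n, g n ∈ H := fun n => hH _ a.2 _ (hg n)
  constructor
  · rintro ⟨p, hp⟩ hpf
    obtain ⟨n, rfl⟩ := mem_seq.1 hpf
    exact ⟨⟨nat n, hH _ hω _ (nat_mem_omega n)⟩, ⟨g n, hgH n⟩, nat_mem_omega n, hg n,
      (isPair_memOn hH).2 rfl⟩
  · rintro ⟨x, hx⟩ hxω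
    obtain ⟨n, rfl⟩ := mem_omega_iff.1 hxω
    refine ⟨⟨g n, hgH n⟩, (pairMem_memOn hH).2 (by simp), fun y hy => ?_⟩
    exact Subtype.ext (pair_mem_seq.1 ((pairMem_memOn hH).1 hy))

end Transitive

/-! ### Dependent choice -/

/-- The elements of `a` that are `r`-related to `x`. -/
noncomputable def relatedIn (a r x : ZFSet.{u}) : ZFSet.{u} := a.sep fun y => ZFSet.pair y x ∈ r

instance dfun_relatedIn {ι : Type} {f g h : (ι → ZFSet.{u}) → ZFSet.{u}} [hf : DFun f]
    [hg : DFun g] [hh : DFun h] : DFun fun v => relatedIn (f v) (g v) (h v) :=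
  .subst₃ (F := relatedIn) (.of_mem_iff
    (R := fun y v => y ∈ v 0 ∧ ZFSet.pair y (v 2) ∈ v 1) fun _ _ => ZFSet.mem_sep) hf hg hh

/-- Since chosen elements are unique, induction on `n` shows that `seq g` is the only function
satisfying the recursion `R`, whose parameters are `a`, `r` and `T`. -/
theorem seq_mem_OD {X : Set ZFSet.{u}} {a r T : ZFSet.{u}} {g : ℕ → ZFSet.{u}} (ha : a ∈ OD X)
    (hr : r ∈ OD X) (hT : T ∈ X) (hg : ∀ n, g n ∈ a) (h0 : IsChosen (g 0) a (row T (nat 0)))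
    (hsucc : ∀ n, IsChosen (g (n + 1)) (relatedIn a r (g n)) (row T (nat (n + 1)))) :
    seq g ∈ OD X := by
  rw [OD_eq_dcl] at *
  let R : (Fin 3 → ZFSet.{u}) → ZFSet.{u} → Prop := fun p f =>
    ZFSet.IsFunc ZFSet.omega (p 0) f ∧ IsChosen (app f (nat 0)) (p 0) (row (p 2) (nat 0)) ∧
    ∀ n, n ∈ ZFSet.omega → IsChosen (app f (insert n n)) (relatedIn (p 0) (p 1) (app f n))
      (row (p 2) (insert n n))
  refine mem_dcl_of_dfn (R := R) (p := ![a, r, T]) inferInstance ?_ ?_ ?_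
  · simp only [Fin.forall_fin_succ]
    exact ⟨ha, hr, subset_dcl (.inr hT), fun i => i.elim0⟩
  · refine ⟨isFunc_omega_iff.2 ⟨g, hg, rfl⟩, by simpa using h0, fun n hn => ?_⟩
    obtain ⟨n, rfl⟩ := mem_omega_iff.1 hn
    rw [← nat_succ, app_seq, app_seq]
    exact hsucc n
  · rintro f ⟨hf, hf0, hfs⟩
    obtain ⟨g', -, rfl⟩ := isFunc_omega_iff.1 hf
    refine congrArg seq (funext fun n => ?_)
    induction n with
    | zero =>
      rw [app_seq] at hf0
      exact hf0.unique h0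
    | succ n ih =>
      have := hfs _ (nat_mem_omega n)
      rw [← nat_succ, app_seq, app_seq, ih] at this
      exact this.unique (hsucc n)

theorem exists_seq_mem_HOD {M : Set ZFSet.{u}} (hM : M.Nonempty) {a r : ZFSet.{u}}
    (ha : a ∈ HOD (omegaSeq M)) (hr : r ∈ HOD (omegaSeq M)) (hne : ∃ x, x ∈ a)
    (hstep : ∀ x ∈ a, ∃ y ∈ a, ZFSet.pair y x ∈ r) :
    ∃ g : ℕ → ZFSet.{u}, (∀ n, g n ∈ a) ∧ (∀ n, ZFSet.pair (g (n + 1)) (g n) ∈ r) ∧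
      seq g ∈ HOD (omegaSeq M) := by
  have hchoose : ∀ {x Z}, x ∈ a → x ∈ Z → ∃ t ∈ omegaSeq M, ∃ y, IsChosen y Z t := by
    intro x Z hx hxZ
    obtain ⟨t, ht, U, n, hU, hd⟩ :=
      exists_isDefinedIn_of_mem_OD hM (mem_OD_of_mem_HOD (mem_HOD_of_mem ha hx))
    exact ⟨t, ht, exists_isChosen hxZ hU hd⟩
  have hnext : ∀ x : a, ∃ t ∈ omegaSeq M, ∃ y : a, IsChosen y (relatedIn a r x) t := by
    rintro ⟨x, hx⟩
    obtain ⟨y, hy, hyx⟩ := hstep x hx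
    obtain ⟨t, ht, z, hz⟩ := hchoose hy (ZFSet.mem_sep.2 ⟨hy, hyx⟩ : y ∈ relatedIn a r x)
    exact ⟨t, ht, ⟨z, (ZFSet.mem_sep.1 hz.1).1⟩, hz⟩
  obtain ⟨x₀, hx₀⟩ := hne
  obtain ⟨t₀, ht₀, y₀, hy₀⟩ := hchoose hx₀ hx₀
  -- Choice is essential only for `t`: once `t x` is fixed, `y x` is determined by
  -- `IsChosen.unique`.
  choose t ht y hy using hnext
  obtain ⟨g, hg0, hgs⟩ : ∃ g : ℕ → a, g 0 = ⟨y₀, hy₀.1⟩ ∧ ∀ n, g (n + 1) = y (g n) :=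
    ⟨fun n => y^[n] ⟨y₀, hy₀.1⟩, rfl, fun n => Function.iterate_succ_apply' _ _ _⟩
  -- The index is shifted: `s (n + 1)` is the parameter that selects `g (n + 1)` as a successor of
  -- `g n`, and `s 0` selects the starting point.
  obtain ⟨s, hs0, hss⟩ : ∃ s : ℕ → ZFSet.{u}, s 0 = t₀ ∧ ∀ n, s (n + 1) = t (g n) :=
    ⟨fun n => n.casesOn t₀ fun n => t (g n), rfl, fun _ => rfl⟩
  have hs : ∀ n, s n ∈ omegaSeq M := by
    rintro (_ | n)
    · rwa [hs0]
    · rw [hss]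
      exact ht _
  choose F hFM hF using fun n => mem_omegaSeq.1 (hs n)
  have hrow : ∀ n, row (join F) (nat n) = s n := fun n => (row_join F n).trans (hF n).symm
  have hgsucc : ∀ n, IsChosen (g (n + 1)) (relatedIn a r (g n)) (s (n + 1)) := fun n => by
    rw [hgs, hss]
    exact hy (g n)
  refine ⟨fun n => g n, fun n => (g n).2, fun n => (ZFSet.mem_sep.1 (hgsucc n).1).2,
    mem_HOD_iff.2 ⟨?_, fun p hp => ?_⟩⟩
  · refine seq_mem_OD (mem_OD_of_mem_HOD ha) (mem_OD_of_mem_HOD hr) (join_mem_omegaSeq hFM)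
      (fun n => (g n).2) ?_ fun n => ?_
    · rw [hrow, hg0, hs0]
      exact hy₀
    · rw [hrow]
      exact hgsucc n
  · obtain ⟨n, rfl⟩ := mem_seq.1 hp
    exact pair_mem_HOD (nat_mem_HOD n) (mem_HOD_of_mem ha (g n).2)

/-- If `M` is a nonempty class, then `HOD(M^ω)` satisfies dependent choice. -/
theorem satisfiesDC_HOD_omegaSeq {M : Set ZFSet.{u}} (hM : M.Nonempty) :
    SatisfiesDC (memOn (HOD (omegaSeq M))) := by
  have hH : ∀ x ∈ HOD (omegaSeq M), ∀ y ∈ x, y ∈ HOD (omegaSeq M) :=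
    fun _ hx _ hy => mem_HOD_of_mem hx hy
  intro a r hne hstep
  obtain ⟨g, hga, hgr, hg⟩ := exists_seq_mem_HOD hM a.2 r.2
    (hne.imp' Subtype.val fun _ => id) fun x hx => by
      obtain ⟨y, hy, hyx⟩ := hstep ⟨x, hH _ a.2 _ hx⟩ hx
      exact ⟨y, hy, (pairMem_memOn hH).1 hyx⟩
  refine ⟨⟨ZFSet.omega, omega_mem_HOD⟩, ⟨_, hg⟩, isOmega_memOn hH _,
    isFunction_memOn hH _ hga hg, ?_⟩
  rintro ⟨n, hn⟩ ⟨m, hm⟩ x y hnω hmn hxf hyf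
  obtain ⟨n, rfl⟩ := mem_omega_iff.1 hnω
  obtain rfl : m = nat (n + 1) := ((isSucc_memOn hH).1 hmn).trans (nat_succ n).symm
  refine (pairMem_memOn hH).2 ?_
  rw [pair_mem_seq.1 ((pairMem_memOn hH).1 hxf), pair_mem_seq.1 ((pairMem_memOn hH).1 hyf)]
  exact hgr n

/-! ### Sets of natural numbers and their indicator functions -/

/-- A subset of `ω` and its indicator function are definable from each other. -/
theorem OD_powersetOmega : OD powersetOmega.{u} = OD (omegaSeq {∅, {∅}}) := by
  rw [OD_eq_dcl, OD_eq_dcl]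
  refine Set.Subset.antisymm (dcl_subset_dcl ?_) (dcl_subset_dcl ?_)
  · classical
    rintro x (hx | hx)
    · exact subset_dcl (.inl hx)
    · let g : ℕ → ZFSet.{u} := fun n => if nat n ∈ x then {∅} else ∅
      have hg : seq g ∈ omegaSeq {∅, {∅}} := mem_omegaSeq.2 ⟨g, fun n => by
        by_cases h : nat n ∈ x <;> simp [g, h], rfl⟩
      have hmem : ∀ z, z ∈ x ↔ z ∈ ZFSet.omega ∧ ZFSet.pair z {∅} ∈ seq g := by
        intro z
        constructor
        · intro hz
          have hzω := ZFSet.mem_powerset.1 hx hz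
          obtain ⟨n, rfl⟩ := mem_omega_iff.1 hzω
          exact ⟨hzω, by simp [g, hz]⟩
        · rintro ⟨hzω, hz⟩
          obtain ⟨n, rfl⟩ := mem_omega_iff.1 hzω
          by_contra h
          rw [pair_mem_seq] at hz
          dsimp only [g] at hz
          rw [if_neg h] at hz
          exact ZFSet.notMem_empty ∅
            (hz.subst (motive := fun z => ∅ ∈ z) (ZFSet.mem_singleton.2 rfl))
      refine mem_dcl_of_dfn (ι := Unit) (p := fun _ => seq g) (R := fun p x =>
        ∀ z, z ∈ x ↔ z ∈ ZFSet.omega ∧ ZFSet.pair z {∅} ∈ p ()) inferInstance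
        (fun _ => subset_dcl (.inr hg)) hmem fun y hy => ?_
      ext z
      rw [hy, hmem]
  · rintro f (hf | hf)
    · exact subset_dcl (.inl hf)
    · obtain ⟨g, hg, rfl⟩ := mem_omegaSeq.1 hf
      let x : ZFSet.{u} := ZFSet.omega.sep fun z => ZFSet.pair z {∅} ∈ seq g
      have hx : ∀ n, nat n ∈ x ↔ g n = {∅} := fun n => by
        simp [x, ZFSet.mem_sep, eq_comm]
      have hmem : ∀ z, z ∈ seq g ↔ ∃ n, n ∈ ZFSet.omega ∧
          (n ∈ x ∧ z = ZFSet.pair n {∅} ∨ ¬ n ∈ x ∧ z = ZFSet.pair n ∅) := by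
        intro z
        rw [mem_seq]
        have key : ∀ n, z = ZFSet.pair (nat n) (g n) ↔
            (nat n ∈ x ∧ z = ZFSet.pair (nat n) {∅} ∨ ¬ nat n ∈ x ∧ z = ZFSet.pair (nat n) ∅) := by
          intro n
          rw [hx]
          by_cases h : g n = {∅}
          · simp [h]
          · have h' : g n = ∅ := (hg n).resolve_right h
            rw [h'] at h ⊢
            simp [h]
        constructor
        · rintro ⟨n, hn⟩
          exact ⟨nat n, nat_mem_omega n, (key n).1 hn⟩
        · rintro ⟨n, hn, h⟩
          obtain ⟨n, rfl⟩ := mem_omega_iff.1 hn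
          exact ⟨n, (key n).2 h⟩
      refine mem_dcl_of_dfn (ι := Unit) (p := fun _ => x) (R := fun p f =>
        ∀ z, z ∈ f ↔ ∃ n, n ∈ ZFSet.omega ∧
          (n ∈ p () ∧ z = ZFSet.pair n {∅} ∨ ¬ n ∈ p () ∧ z = ZFSet.pair n ∅)) inferInstance
        (fun _ => subset_dcl (.inr (ZFSet.mem_powerset.2 ZFSet.sep_subset))) hmem fun y hy => ?_
      ext z
      rw [hy, hmem]

end HODModels

/-! ### Dependent choice for inner models and for `P(ω)` -/

theorem theorem7p3p2 :
    (∀ M : Set ZFSet.{u}, HODModels.IsInnerModel M →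
      HODModels.SatisfiesDC (HODModels.memOn (HODModels.HOD (HODModels.omegaSeq M)))) ∧
    HODModels.SatisfiesDC (HODModels.memOn (HODModels.HOD HODModels.powersetOmega.{u})) := by
  refine ⟨fun M hM =>
    HODModels.satisfiesDC_HOD_omegaSeq ⟨∅, hM.ordinals ∅ ZFSet.isOrdinal_empty⟩, ?_⟩
  have h : HODModels.HOD HODModels.powersetOmega.{u} =
      HODModels.HOD (HODModels.omegaSeq {∅, {∅}}) := by
    rw [HODModels.HOD, HODModels.HOD, HODModels.OD_powersetOmega]
  rw [h]
  exact HODModels.satisfiesDC_HOD_omegaSeq ⟨∅, by simp⟩
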